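/- **Two theories of arithmetic in intuitionistic predicate logic.** Provability is provability in intuitionistic natural deduction for (many-sorted) first-order logic with primitive connectives $\bot,\top,\wedge,\vee,\Rightarrow,\forall,\exists$, where $\neg A$ is $A\Rightarrow\bot$ and $A\Leftrightarrow B$ is $(A\Rightarrow B)\wedge(B\Rightarrow A)$; equality is an ordinary predicate symbol. Every sort has infinitely many variables. *The theory $\mathrm{HA}_N$* is one-sorted, with function symbols $0$, $S$, $\mathit{Pred}$, $+$, $\times$ and predicate symbols $=$ (binary), $\mathit{Null}$, $N$ (unary). Its axioms are: - the axioms of equality: reflexivity, symmetry and transitivity of $=$, and compatibility of $=$ with $S$, $\mathit{Pred}$, $+$, $\times$, $\mathit{Null}$ and $N$; - for every proposition $P$ of this language, the universal closure of $$(0/x)P \Rightarrow \forall y\,\bigl(N(y)\Rightarrow (y/x)P\Rightarrow (S(y)/x)P\bigr)\Rightarrow \forall n\,\bigl(N(n)\Rightarrow (n/x)P\bigr);$$ - $N(0)$ and $\forall x\,(N(x)\Rightarrow N(S(x)))$; - the defining axioms $\mathit{Pred}(0)=0$, $\forall x\,(\mathit{Pred}(S(x))=x)$, $\mathit{Null}(0)$,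 $\forall x\,\neg\mathit{Null}(S(x))$, $\forall y\,(0+y=y)$, $\forall x\forall y\,(S(x)+y=S(x+y))$, $\forall y\,(0\times y=0)$, $\forall x\forall y\,(S(x)\times y=x\times y+y)$. *The theory $\mathrm{HA}_{Class}$* has two sorts, $\iota$ (numbers) and $\kappa$ (classes of numbers). Its language has the symbols of $\mathrm{HA}_N$ on the sort $\iota$, a predicate symbol $\in$ of rank $\langle\iota,\kappa\rangle$, and, for every proposition $P$ in the language of $\mathrm{HA}_N$ with free variables among $x,y_1,\dots,y_n$ ($n\ge 0$), a function symbol $f_{x,y_1,\dots,y_n,P}$ that takes $n$ arguments of sort $\iota$ and yields a result of sort $\kappa$. Its axioms are the same defining axioms of $\mathit{Pred}$, $\mathit{Null}$, $+$ and $\times$, together with $$\forall y\forall z\,\bigl(y=z\Leftrightarrow\forall p\,(y\in p\Rightarrow z\in p)\bigr),$$ $$\forall n\,\Bigl(N(n)\Leftrightarrow\forall p\,\bigl(0\in p\Rightarrow\forall y\,(N(y)\Rightarrow y\in p\Rightarrow S(y)\in p)\Rightarrow n\in p\bigr)\Bigr),$$ and, for each symbol $f_{x,y_1,\dots,y_n,P}$,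 $$\forall x\forall y_1\cdots\forall y_n\,\bigl(x\in f_{x,y_1,\dots,y_n,P}(y_1,\dots,y_n)\Leftrightarrow P\bigr).$$ **Proposition.** $\mathrm{HA}_{Class}$ is a conservative extension of $\mathrm{HA}_N$: for every proposition $A$ in the language of $\mathrm{HA}_N$ (with or without free variables, its variables and quantifiers being read over the sort $\iota$ in $\mathrm{HA}_{Class}$), $A$ is provable in $\mathrm{HA}_{Class}$ if and only if $A$ is provable in $\mathrm{HA}_N$. -/

import Mathlib

namespace ModArith

/-! ## Many-sorted intuitionistic predicate logic -/

/-- A many-sorted first-order language: sorts, function symbols of rank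
`⟨s₁, …, sₙ, sₙ₊₁⟩` and predicate symbols of rank `⟨s₁, …, sₙ⟩`. -/
structure Signature where
  Srt : Type
  [decSrt : DecidableEq Srt]
  Fn : Type
  fnArity : Fn → ℕ
  fnDom : (f : Fn) → Fin (fnArity f) → Srt
  fnCod : Fn → Srt
  Rel : Type
  relArity : Rel → ℕ
  relDom : (R : Rel) → Fin (relArity R) → Srt

attribute [instance] Signature.decSrt

/-- Terms of each sort. Every sort `s` has its own infinite supply of variables
`var s 0, var s 1, …`, read as de Bruijn indices under the quantifiers of sort `s`. -/
inductive Term (L : Signature) : L.Srt → Type where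
  | var (s : L.Srt) (n : ℕ) : Term L s
  | app (f : L.Fn) (ts : (i : Fin (L.fnArity f)) → Term L (L.fnDom f i)) : Term L (L.fnCod f)

/-- Propositions. In `all s A` and `ex s A` the variable `var s 0` of `A` is bound, and
`var s (k + 1)` inside `A` refers to the variable `var s k` outside; variables of the other
sorts are not affected. -/
inductive Formula (L : Signature) : Type where
  | rel (R : L.Rel) (ts : (i : Fin (L.relArity R)) → Term L (L.relDom R i)) : Formula L
  | bot : Formula L
  | top : Formula L
  | and (A B : Formula L) : Formula L
  | or (A B : Formula L) : Formula L
  | imp (A B : Formula L) : Formula L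
  | all (s : L.Srt) (A : Formula L) : Formula L
  | ex (s : L.Srt) (A : Formula L) : Formula L

infixr:60 " ⇒ₚ " => Formula.imp
infixr:70 " ∧ₚ " => Formula.and

/-- Negation `A ⇒ ⊥`. -/
def Formula.neg {L : Signature} (A : Formula L) : Formula L := A ⇒ₚ Formula.bot

/-- Equivalence `(A ⇒ B) ∧ (B ⇒ A)`. -/
def Formula.iff {L : Signature} (A B : Formula L) : Formula L := (A ⇒ₚ B) ∧ₚ (B ⇒ₚ A)

infix:55 " ⇔ₚ " => Formula.iff

/-- `n` quantifiers `∀` of sort `s` in front of `A`; they bind `var s 0, …, var s (n - 1)`. -/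
def Formula.alls {L : Signature} (s : L.Srt) : ℕ → Formula L → Formula L
  | 0, A => A
  | n + 1, A => Formula.alls s n (Formula.all s A)

/-- Put the value `x` at index `0` of sort `s`, moving the values at sort `s` up by one. -/
def scons {S : Type} [DecidableEq S] {X : S → Type*} (s : S) (x : X s)
    (σ : (s' : S) → ℕ → X s') : (s' : S) → ℕ → X s' :=
  Function.update σ s (fun n => match n with
    | 0 => x
    | k + 1 => σ s k)

/-- Simultaneous substitution in a term. -/
def Term.subst {L : Signature} (σ : (s : L.Srt) → ℕ → Term L s) :
    {s : L.Srt} → Term L s → Term L s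
  | _, .var s n => σ s n
  | _, .app f ts => .app f (fun i => (ts i).subst σ)

/-- The substitution `var s k ↦ var s (k + 1)`, identity on the other sorts. -/
def shiftSub {L : Signature} (s : L.Srt) : (s' : L.Srt) → ℕ → Term L s' :=
  Function.update (fun s' n => Term.var s' n) s (fun n => Term.var s (n + 1))

/-- The substitution to be used below a quantifier of sort `s`. -/
def liftSub {L : Signature} (s : L.Srt) (σ : (s' : L.Srt) → ℕ → Term L s') :
    (s' : L.Srt) → ℕ → Term L s' :=
  scons s (Term.var s 0) (fun s' n => (σ s' n).subst (shiftSub s))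

/-- Simultaneous capture-avoiding substitution in a proposition. -/
def Formula.subst {L : Signature} : ((s : L.Srt) → ℕ → Term L s) → Formula L → Formula L
  | σ, .rel R ts => .rel R (fun i => (ts i).subst σ)
  | _, .bot => .bot
  | _, .top => .top
  | σ, .and A B => .and (A.subst σ) (B.subst σ)
  | σ, .or A B => .or (A.subst σ) (B.subst σ)
  | σ, .imp A B => .imp (A.subst σ) (B.subst σ)
  | σ, .all s A => .all s (A.subst (liftSub s σ))
  | σ, .ex s A => .ex s (A.subst (liftSub s σ))

/-- `A` read below one more quantifier of sort `s`, whose variable does not occur in it. -/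
def Formula.shift {L : Signature} (s : L.Srt) (A : Formula L) : Formula L :=
  A.subst (shiftSub s)

/-- `(t/x)A`, where `x` is the variable `var s 0` of `A`. -/
def Formula.inst {L : Signature} {s : L.Srt} (t : Term L s) (A : Formula L) : Formula L :=
  A.subst (scons s t (fun s' n => Term.var s' n))

/-- The variable `var s k` occurs in the term. -/
def Term.HasVar {L : Signature} (s : L.Srt) (k : ℕ) : {s' : L.Srt} → Term L s' → Prop
  | _, .var s' n => s' = s ∧ n = k
  | _, .app _ ts => ∃ i, (ts i).HasVar s k

/-- The variable `var s k` occurs free in the proposition. -/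
def Formula.HasFree {L : Signature} (s : L.Srt) : ℕ → Formula L → Prop
  | k, .rel _ ts => ∃ i, (ts i).HasVar s k
  | _, .bot => False
  | _, .top => False
  | k, .and A B => A.HasFree s k ∨ B.HasFree s k
  | k, .or A B => A.HasFree s k ∨ B.HasFree s k
  | k, .imp A B => A.HasFree s k ∨ B.HasFree s k
  | k, .all s' A => A.HasFree s (if s = s' then k + 1 else k)
  | k, .ex s' A => A.HasFree s (if s = s' then k + 1 else k)

/-- `Provable Γ A`: the sequent `Γ ⊢ A` has a proof in intuitionistic natural deduction.
The side condition "`x` is not free in `Γ`" (and in `B`) of the rules `allI` and `exE` is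
expressed by shifting `Γ` (and `B`) below the new variable. -/
inductive Provable {L : Signature} : Set (Formula L) → Formula L → Prop where
  | hyp {Γ A} : A ∈ Γ → Provable Γ A
  | impI {Γ A B} : Provable (insert A Γ) B → Provable Γ (A ⇒ₚ B)
  | impE {Γ A B} : Provable Γ (A ⇒ₚ B) → Provable Γ A → Provable Γ B
  | andI {Γ A B} : Provable Γ A → Provable Γ B → Provable Γ (A ∧ₚ B)
  | andE₁ {Γ A B} : Provable Γ (A ∧ₚ B) → Provable Γ A
  | andE₂ {Γ A B} : Provable Γ (A ∧ₚ B) → Provable Γ B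
  | orI₁ {Γ A B} : Provable Γ A → Provable Γ (.or A B)
  | orI₂ {Γ A B} : Provable Γ B → Provable Γ (.or A B)
  | orE {Γ A B C} : Provable Γ (.or A B) → Provable (insert A Γ) C →
      Provable (insert B Γ) C → Provable Γ C
  | topI {Γ} : Provable Γ .top
  | botE {Γ A} : Provable Γ .bot → Provable Γ A
  | allI {Γ s A} : Provable (Formula.shift s '' Γ) A → Provable Γ (.all s A)
  | allE {Γ s A} (t : Term L s) : Provable Γ (.all s A) → Provable Γ (A.inst t)
  | exI {Γ s A} (t : Term L s) : Provable Γ (A.inst t) → Provable Γ (.ex s A)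
  | exE {Γ s A B} : Provable Γ (.ex s A) →
      Provable (insert A (Formula.shift s '' Γ)) (B.shift s) → Provable Γ B

/-! ## The theory `HA_N` -/

namespace HAN

/-- The function symbols `0`, `S`, `Pred`, `+`, `×`. -/
inductive Fn : Type where
  | zero | succ | pred | add | mul

/-- The predicate symbols `=`, `Null`, `N`. -/
inductive Rel : Type where
  | eq | null | nat

/-- The one-sorted language of `HA_N`. -/
@[reducible] def lang : Signature where
  Srt := Unit
  Fn := Fn
  fnArity
    | .zero => 0
    | .succ => 1
    | .pred => 1
    | .add => 2
    | .mul => 2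
  fnDom _ _ := ()
  fnCod _ := ()
  Rel := Rel
  relArity
    | .eq => 2
    | .null => 1
    | .nat => 1
  relDom _ _ := ()

/-- The variable of index `n`. -/
def v (n : ℕ) : Term lang () := .var (L := lang) () n
def zero : Term lang () := .app (L := lang) Fn.zero (fun i => i.elim0)
def succ (t : Term lang ()) : Term lang () := .app (L := lang) Fn.succ ![t]
def pred (t : Term lang ()) : Term lang () := .app (L := lang) Fn.pred ![t]
def add (t u : Term lang ()) : Term lang () := .app (L := lang) Fn.add ![t, u]
def mul (t u : Term lang ()) : Term lang () := .app (L := lang) Fn.mul ![t, u]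
def eq (t u : Term lang ()) : Formula lang := .rel (L := lang) Rel.eq ![t, u]
def null (t : Term lang ()) : Formula lang := .rel (L := lang) Rel.null ![t]
def nat (t : Term lang ()) : Formula lang := .rel (L := lang) Rel.nat ![t]
def all (A : Formula lang) : Formula lang := .all (L := lang) () A

/-- `(S(x)/x)P`, where `x` is the variable of index `0`. -/
def succInst (P : Formula lang) : Formula lang :=
  P.subst (fun _ n => match n with
    | 0 => succ (v 0)
    | k + 1 => v (k + 1))

/-- The axioms of `HA_N`. The induction axiom for `P` is closed by universal quantifiers over
the parameters of `P`: the induction variable has index `0` in `P`, the parameters have the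
indices `1, …, n`. -/
inductive Theory : Set (Formula lang) where
  | eq_refl : Theory (all (eq (v 0) (v 0)))
  | eq_symm : Theory (all (all (eq (v 1) (v 0) ⇒ₚ eq (v 0) (v 1))))
  | eq_trans : Theory (all (all (all
      (eq (v 2) (v 1) ⇒ₚ eq (v 1) (v 0) ⇒ₚ eq (v 2) (v 0)))))
  | eq_succ : Theory (all (all (eq (v 1) (v 0) ⇒ₚ eq (succ (v 1)) (succ (v 0)))))
  | eq_pred : Theory (all (all (eq (v 1) (v 0) ⇒ₚ eq (pred (v 1)) (pred (v 0)))))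
  | eq_add : Theory (all (all (all (all
      (eq (v 3) (v 2) ⇒ₚ eq (v 1) (v 0) ⇒ₚ eq (add (v 3) (v 1)) (add (v 2) (v 0)))))))
  | eq_mul : Theory (all (all (all (all
      (eq (v 3) (v 2) ⇒ₚ eq (v 1) (v 0) ⇒ₚ eq (mul (v 3) (v 1)) (mul (v 2) (v 0)))))))
  | eq_null : Theory (all (all (eq (v 1) (v 0) ⇒ₚ null (v 1) ⇒ₚ null (v 0))))
  | eq_nat : Theory (all (all (eq (v 1) (v 0) ⇒ₚ nat (v 1) ⇒ₚ nat (v 0))))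
  | induction (n : ℕ) (P : Formula lang) (hP : ∀ k, P.HasFree () k → k < n + 1) :
      Theory (Formula.alls (L := lang) () n
        (P.inst zero ⇒ₚ all (nat (v 0) ⇒ₚ P ⇒ₚ succInst P) ⇒ₚ all (nat (v 0) ⇒ₚ P)))
  | nat_zero : Theory (nat zero)
  | nat_succ : Theory (all (nat (v 0) ⇒ₚ nat (succ (v 0))))
  | pred_zero : Theory (eq (pred zero) zero)
  | pred_succ : Theory (all (eq (pred (succ (v 0))) (v 0)))
  | null_zero : Theory (null zero)
  | null_succ : Theory (all (null (succ (v 0))).neg)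
  | zero_add : Theory (all (eq (add zero (v 0)) (v 0)))
  | succ_add : Theory (all (all (eq (add (succ (v 1)) (v 0)) (succ (add (v 1) (v 0))))))
  | zero_mul : Theory (all (eq (mul zero (v 0)) zero))
  | succ_mul : Theory (all (all
      (eq (mul (succ (v 1)) (v 0)) (add (mul (v 1) (v 0)) (v 0)))))

end HAN

/-! ## The theory `HA_Class` -/

namespace HAClass

/-- The sorts `ι` (numbers) and `κ` (classes of numbers). -/
inductive Srt : Type where
  | ι | κ
  deriving DecidableEq

/-- The function symbols `0`, `S`, `Pred`, `+`, `×` and, for each proposition `P` of the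
language of `HA_N` with free variables among `x, y₁, …, yₙ`, the symbol `f_{x,y₁,…,yₙ,P}`;
here `x` has index `0` in `P` and `yᵢ` has index `i`. -/
inductive Fn : Type where
  | zero | succ | pred | add | mul
  | cls (n : ℕ) (P : Formula HAN.lang) (hP : ∀ k, P.HasFree () k → k < n + 1)

/-- The predicate symbols `=`, `Null`, `N`, `∈`. -/
inductive Rel : Type where
  | eq | null | nat | mem

/-- The two-sorted language of `HA_Class`. -/
@[reducible] def lang : Signature where
  Srt := Srt
  Fn := Fn
  fnArity
    | .zero => 0
    | .succ => 1
    | .pred => 1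
    | .add => 2
    | .mul => 2
    | .cls n _ _ => n
  fnDom _ _ := Srt.ι
  fnCod
    | .zero => Srt.ι
    | .succ => Srt.ι
    | .pred => Srt.ι
    | .add => Srt.ι
    | .mul => Srt.ι
    | .cls _ _ _ => Srt.κ
  Rel := Rel
  relArity
    | .eq => 2
    | .null => 1
    | .nat => 1
    | .mem => 2
  relDom
    | .eq => fun _ => Srt.ι
    | .null => fun _ => Srt.ι
    | .nat => fun _ => Srt.ι
    | .mem => ![Srt.ι, Srt.κ]

/-- The variable of sort `ι` and index `n`. -/
def v (n : ℕ) : Term lang Srt.ι := .var (L := lang) Srt.ι n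
/-- The variable of sort `κ` and index `n`. -/
def c (n : ℕ) : Term lang Srt.κ := .var (L := lang) Srt.κ n
def zero : Term lang Srt.ι := .app (L := lang) Fn.zero (fun i => i.elim0)
def succ (t : Term lang Srt.ι) : Term lang Srt.ι := .app (L := lang) Fn.succ ![t]
def pred (t : Term lang Srt.ι) : Term lang Srt.ι := .app (L := lang) Fn.pred ![t]
def add (t u : Term lang Srt.ι) : Term lang Srt.ι := .app (L := lang) Fn.add ![t, u]
def mul (t u : Term lang Srt.ι) : Term lang Srt.ι := .app (L := lang) Fn.mul ![t, u]
/-- The term `f_{x,y₁,…,yₙ,P}(t₁, …, tₙ)`. -/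
def cls (n : ℕ) (P : Formula HAN.lang) (hP : ∀ k, P.HasFree () k → k < n + 1)
    (ts : Fin n → Term lang Srt.ι) : Term lang Srt.κ :=
  .app (L := lang) (Fn.cls n P hP) ts
def eq (t u : Term lang Srt.ι) : Formula lang := .rel (L := lang) Rel.eq ![t, u]
def null (t : Term lang Srt.ι) : Formula lang := .rel (L := lang) Rel.null ![t]
def nat (t : Term lang Srt.ι) : Formula lang := .rel (L := lang) Rel.nat ![t]
def mem (t : Term lang Srt.ι) (p : Term lang Srt.κ) : Formula lang :=
  .rel (L := lang) Rel.mem (fun i => match i with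
    | 0 => t
    | 1 => p)
/-- Quantification over numbers. -/
def all (A : Formula lang) : Formula lang := .all (L := lang) Srt.ι A
/-- Quantification over classes. -/
def allC (A : Formula lang) : Formula lang := .all (L := lang) Srt.κ A

/-- A term of the language of `HA_N`, seen as a term of sort `ι` of the language of `HA_Class`. -/
def ofTerm : {s : Unit} → Term HAN.lang s → Term lang Srt.ι
  | _, .var _ n => v n
  | _, .app HAN.Fn.zero _ => zero
  | _, .app HAN.Fn.succ ts => succ (ofTerm (ts 0))
  | _, .app HAN.Fn.pred ts => pred (ofTerm (ts 0))
  | _, .app HAN.Fn.add ts => add (ofTerm (ts 0)) (ofTerm (ts 1))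
  | _, .app HAN.Fn.mul ts => mul (ofTerm (ts 0)) (ofTerm (ts 1))

/-- A proposition of the language of `HA_N`, seen as a proposition of the language of
`HA_Class`. -/
def ofFormula : Formula HAN.lang → Formula lang
  | .rel HAN.Rel.eq ts => eq (ofTerm (ts 0)) (ofTerm (ts 1))
  | .rel HAN.Rel.null ts => null (ofTerm (ts 0))
  | .rel HAN.Rel.nat ts => nat (ofTerm (ts 0))
  | .bot => .bot
  | .top => .top
  | .and A B => .and (ofFormula A) (ofFormula B)
  | .or A B => .or (ofFormula A) (ofFormula B)
  | .imp A B => .imp (ofFormula A) (ofFormula B)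
  | .all _ A => .all (L := lang) Srt.ι (ofFormula A)
  | .ex _ A => .ex (L := lang) Srt.ι (ofFormula A)

/-- The axioms of `HA_Class`. -/
inductive Theory : Set (Formula lang) where
  | eq_iff : Theory (all (all
      (eq (v 1) (v 0) ⇔ₚ allC (mem (v 1) (c 0) ⇒ₚ mem (v 0) (c 0)))))
  | nat_iff : Theory (all
      (nat (v 0) ⇔ₚ allC (mem zero (c 0) ⇒ₚ
        all (nat (v 0) ⇒ₚ mem (v 0) (c 0) ⇒ₚ mem (succ (v 0)) (c 0)) ⇒ₚ mem (v 0) (c 0))))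
  | mem_cls (n : ℕ) (P : Formula HAN.lang) (hP : ∀ k, P.HasFree () k → k < n + 1) :
      Theory (Formula.alls (L := lang) Srt.ι (n + 1)
        (mem (v 0) (cls n P hP (fun i => v (i + 1))) ⇔ₚ ofFormula P))
  | pred_zero : Theory (eq (pred zero) zero)
  | pred_succ : Theory (all (eq (pred (succ (v 0))) (v 0)))
  | null_zero : Theory (null zero)
  | null_succ : Theory (all (null (succ (v 0))).neg)
  | zero_add : Theory (all (eq (add zero (v 0)) (v 0)))
  | succ_add : Theory (all (all (eq (add (succ (v 1)) (v 0)) (succ (add (v 1) (v 0))))))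
  | zero_mul : Theory (all (eq (mul zero (v 0)) zero))
  | succ_mul : Theory (all (all
      (eq (mul (succ (v 1)) (v 0)) (add (mul (v 1) (v 0)) (v 0)))))

end HAClass

end ModArith

/-! The argument is semantic, with models whose truth values lie in a frame (a complete Heyting
algebra). Soundness (`Provable.le_eval`) is an induction on derivations. Completeness
(`SubstClosed.provable_of_forall_valid`) uses a single model: the domain is the terms, and the truth
values are the MacNeille completion of propositions preordered by entailment. This completion is a
frame because entailment has implication, and it preserves the meets and joins that already exist,
among them those given by quantifiers. It therefore suffices to pass between models of the two
theories without changing the truth of arithmetical propositions.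

A model of `HA_N` becomes one of `HA_Class` when the classes are taken to be the propositions with
values for their parameters (`expand`). Comprehension then holds by construction. The axiom for
equality holds because equality is a congruence for all propositions (`eval_of_eqVal`), with the
class of all `x` such that `a = x` for the converse. The axiom for `N` holds by the induction
schema, with `N` itself as the class for the converse.

Conversely, the numbers of a model of `HA_Class` form a model of `HA_N` (`valid_reduct`).
Comprehension makes every arithmetical proposition with parameters a class, so quantification over
classes yields Leibniz's principle and every instance of induction. -/

namespace ModArith

/-! ### Substitution calculus and free variables -/

section Substitution

variable {L : Signature}

section Scons

variable {S : Type} [DecidableEq S] {X : S → Type*}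

@[simp] theorem scons_zero (s : S) (x : X s) (σ : (s' : S) → ℕ → X s') :
    scons s x σ s 0 = x := by simp [scons]

@[simp] theorem scons_succ (s : S) (x : X s) (σ : (s' : S) → ℕ → X s') (n : ℕ) :
    scons s x σ s (n + 1) = σ s n := by simp [scons]

theorem scons_of_ne {s s' : S} (h : s' ≠ s) (x : X s) (σ : (s' : S) → ℕ → X s') (n : ℕ) :
    scons s x σ s' n = σ s' n := by simp [scons, h]

/-- Functions on variables agree if they agree at index `0` of `s`, at the positive indices
of `s`, and at the other sorts. -/
theorem var_cases (s : S) {p : (s' : S) → ℕ → Prop} (h0 : p s 0) (h1 : ∀ n, p s (n + 1))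
    (h2 : ∀ s' n, s' ≠ s → p s' n) (s' : S) (n : ℕ) : p s' n := by
  by_cases h : s' = s
  · subst h
    cases n
    exacts [h0, h1 _]
  · exact h2 s' n h

theorem funext_var (s : S) {σ τ : (s' : S) → ℕ → X s'} (h0 : σ s 0 = τ s 0)
    (h1 : ∀ n, σ s (n + 1) = τ s (n + 1)) (h2 : ∀ s' n, s' ≠ s → σ s' n = τ s' n) : σ = τ :=
  funext fun s' => funext fun n => var_cases s (p := fun s' n => σ s' n = τ s' n) h0 h1 h2 s' n

end Scons

@[simp] theorem shiftSub_same (s : L.Srt) (n : ℕ) :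
    shiftSub s s n = (Term.var s (n + 1) : Term L s) := by simp [shiftSub]

theorem shiftSub_of_ne {s s' : L.Srt} (h : s' ≠ s) (n : ℕ) :
    shiftSub s s' n = (Term.var s' n : Term L s') := by simp [shiftSub, h]

@[simp] theorem liftSub_zero (s : L.Srt) (σ : (s' : L.Srt) → ℕ → Term L s') :
    liftSub s σ s 0 = Term.var s 0 := by simp [liftSub]

@[simp] theorem liftSub_succ (s : L.Srt) (σ : (s' : L.Srt) → ℕ → Term L s') (n : ℕ) :
    liftSub s σ s (n + 1) = (σ s n).subst (shiftSub s) := by simp [liftSub]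

theorem liftSub_of_ne {s s' : L.Srt} (h : s' ≠ s) (σ : (s' : L.Srt) → ℕ → Term L s') (n : ℕ) :
    liftSub s σ s' n = (σ s' n).subst (shiftSub s) := by simp [liftSub, scons_of_ne h]

theorem Term.subst_subst (σ τ : (s : L.Srt) → ℕ → Term L s) {s : L.Srt} (t : Term L s) :
    (t.subst σ).subst τ = t.subst fun s n => (σ s n).subst τ := by
  induction t with
  | var => rfl
  | app f ts ih => simp only [Term.subst, ih]

@[simp] theorem Term.subst_var {s : L.Srt} (t : Term L s) : t.subst Term.var = t := by
  induction t with
  | var => rfl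
  | app f ts ih => simp only [Term.subst, ih]

theorem Term.subst_congr {σ τ : (s : L.Srt) → ℕ → Term L s} {s : L.Srt} (t : Term L s)
    (h : ∀ s' k, t.HasVar s' k → σ s' k = τ s' k) : t.subst σ = t.subst τ := by
  induction t with
  | var s n => exact h s n ⟨rfl, rfl⟩
  | app f ts ih =>
    simp only [Term.subst]
    congr 1
    funext i
    exact ih i fun s' k hk => h s' k ⟨i, hk⟩

theorem Term.shift_subst_liftSub (s : L.Srt) (σ : (s : L.Srt) → ℕ → Term L s) {s' : L.Srt}
    (t : Term L s') :
    (t.subst (shiftSub s)).subst (liftSub s σ) = (t.subst σ).subst (shiftSub s) := by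
  rw [Term.subst_subst, Term.subst_subst]
  congr 1
  funext s' n
  by_cases h : s' = s
  · subst h
    simp [Term.subst]
  · simp [shiftSub_of_ne h, Term.subst, liftSub_of_ne h]

theorem liftSub_subst (s : L.Srt) (σ τ : (s : L.Srt) → ℕ → Term L s) :
    (fun s' n => (liftSub s σ s' n).subst (liftSub s τ)) =
      liftSub s fun s' n => (σ s' n).subst τ := by
  refine funext_var s ?_ ?_ ?_
  · simp [Term.subst]
  · intro n
    simp [Term.shift_subst_liftSub]
  · intro s' n h
    simp [liftSub_of_ne h, Term.shift_subst_liftSub]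

theorem Formula.subst_subst (A : Formula L) (σ τ : (s : L.Srt) → ℕ → Term L s) :
    (A.subst σ).subst τ = A.subst fun s n => (σ s n).subst τ := by
  induction A generalizing σ τ with
  | rel R ts => simp only [Formula.subst, Term.subst_subst]
  | bot => rfl
  | top => rfl
  | and A B ihA ihB => simp only [Formula.subst, ihA, ihB]
  | or A B ihA ihB => simp only [Formula.subst, ihA, ihB]
  | imp A B ihA ihB => simp only [Formula.subst, ihA, ihB]
  | all s A ih => simp only [Formula.subst, ih, liftSub_subst]
  | ex s A ih => simp only [Formula.subst, ih, liftSub_subst]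

theorem Formula.subst_congr (A : Formula L) {σ τ : (s : L.Srt) → ℕ → Term L s}
    (h : ∀ s k, A.HasFree s k → σ s k = τ s k) : A.subst σ = A.subst τ := by
  have lift : ∀ {σ τ : (s : L.Srt) → ℕ → Term L s} (s : L.Srt) (A : Formula L),
      (∀ s' k, A.HasFree s' (if s' = s then k + 1 else k) → σ s' k = τ s' k) →
      ∀ s' k, A.HasFree s' k → liftSub s σ s' k = liftSub s τ s' k := by
    intro σ τ s A h
    refine var_cases s ?_ ?_ ?_
    · simp
    · intro n hn
      simp [h s n (by simpa using hn)]
    · intro s' n hs hn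
      simp [liftSub_of_ne hs, h s' n (by simpa [hs] using hn)]
  induction A generalizing σ τ with
  | rel R ts =>
    simp only [Formula.subst]
    congr 1
    funext i
    exact Term.subst_congr _ fun s' k hk => h s' k ⟨i, hk⟩
  | bot => rfl
  | top => rfl
  | and A B ihA ihB =>
    simp only [Formula.subst, ihA fun s k hk => h s k (.inl hk),
      ihB fun s k hk => h s k (.inr hk)]
  | or A B ihA ihB =>
    simp only [Formula.subst, ihA fun s k hk => h s k (.inl hk),
      ihB fun s k hk => h s k (.inr hk)]
  | imp A B ihA ihB =>
    simp only [Formula.subst, ihA fun s k hk => h s k (.inl hk),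
      ihB fun s k hk => h s k (.inr hk)]
  | all s A ih => simp only [Formula.subst, ih (lift s A h)]
  | ex s A ih => simp only [Formula.subst, ih (lift s A h)]

@[simp] theorem liftSub_var (s : L.Srt) : liftSub (L := L) s Term.var = Term.var := by
  refine funext_var s ?_ ?_ ?_
  · simp
  · simp [Term.subst]
  · intro s' n h
    simp [liftSub_of_ne h, Term.subst, shiftSub_of_ne h]

@[simp] theorem Formula.subst_var (A : Formula L) : A.subst Term.var = A := by
  induction A with
  | rel R ts => simp [Formula.subst]
  | bot => rfl
  | top => rfl
  | and A B ihA ihB => simp only [Formula.subst, ihA, ihB]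
  | or A B ihA ihB => simp only [Formula.subst, ihA, ihB]
  | imp A B ihA ihB => simp only [Formula.subst, ihA, ihB]
  | all s A ih => simp only [Formula.subst, liftSub_var, ih]
  | ex s A ih => simp only [Formula.subst, liftSub_var, ih]

theorem Formula.shift_subst_liftSub (s : L.Srt) (σ : (s : L.Srt) → ℕ → Term L s)
    (A : Formula L) : (A.shift s).subst (liftSub s σ) = (A.subst σ).shift s := by
  rw [Formula.shift, Formula.shift, Formula.subst_subst, Formula.subst_subst]
  congr 1
  funext s' n
  exact Term.shift_subst_liftSub s σ (Term.var s' n)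

/-- This matches the quantifier clause of truth, which extends an assignment, with instantiation of
a substituted body; the truth lemma for the term model depends on it. -/
theorem Formula.liftSub_subst_inst (s : L.Srt) (σ : (s : L.Srt) → ℕ → Term L s)
    (A : Formula L) (t : Term L s) :
    (A.subst (liftSub s σ)).inst t = A.subst (scons s t σ) := by
  have shift_inst : ∀ {s'} (u : Term L s'),
      (u.subst (shiftSub s)).subst (scons s t fun s' n => Term.var s' n) = u := by
    intro s' u
    rw [Term.subst_subst]
    conv_rhs => rw [← Term.subst_var u]
    congr 1
    funext s' n
    by_cases h : s' = s
    · subst h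
      simp [Term.subst]
    · simp [shiftSub_of_ne h, Term.subst, scons_of_ne h]
  rw [Formula.inst, Formula.subst_subst]
  congr 1
  refine funext_var s ?_ ?_ ?_
  · simp [Term.subst]
  · simp [shift_inst]
  · intro s' n h
    simp [liftSub_of_ne h, scons_of_ne h, shift_inst]

theorem Formula.inst_subst (s : L.Srt) (σ : (s : L.Srt) → ℕ → Term L s)
    (A : Formula L) (t : Term L s) :
    (A.inst t).subst σ = (A.subst (liftSub s σ)).inst (t.subst σ) := by
  rw [Formula.liftSub_subst_inst, Formula.inst, Formula.subst_subst]
  congr 1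
  refine funext_var s ?_ ?_ ?_
  · simp
  · simp [Term.subst]
  · intro s' n h
    simp [scons_of_ne h, Term.subst]

@[simp] theorem Formula.shift_inst (s : L.Srt) (A : Formula L) (t : Term L s) :
    (A.shift s).inst t = A := by
  rw [Formula.inst, Formula.shift, Formula.subst_subst]
  conv_rhs => rw [← Formula.subst_var A]
  congr 1
  funext s' n
  by_cases h : s' = s
  · subst h
    simp [Term.subst]
  · simp [shiftSub_of_ne h, Term.subst, scons_of_ne h]

theorem Term.exists_hasVar_lt {s : L.Srt} (t : Term L s) :
    ∃ N, ∀ s' k, t.HasVar s' k → k < N := by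
  induction t with
  | var s n => exact ⟨n + 1, fun s' k h => by have := h.2; omega⟩
  | app f ts ih =>
    choose N hN using ih
    refine ⟨Finset.univ.sup N, ?_⟩
    rintro s' k ⟨i, hi⟩
    exact (hN i s' k hi).trans_le (Finset.le_sup (Finset.mem_univ i))

/-- The bound supplies fresh variables for generalization, and a number of parameters for which the
induction axiom or the class symbol of a given proposition exists. -/
theorem Formula.exists_hasFree_lt (A : Formula L) : ∃ N, ∀ s k, A.HasFree s k → k < N := by
  have binary : ∀ {A B : Formula L}, (∃ N, ∀ s k, A.HasFree s k → k < N) →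
      (∃ N, ∀ s k, B.HasFree s k → k < N) →
      ∃ N, ∀ s k, A.HasFree s k ∨ B.HasFree s k → k < N := by
    rintro A B ⟨N, hN⟩ ⟨M, hM⟩
    exact ⟨max N M, fun s k h => h.elim (fun h => lt_max_of_lt_left (hN s k h))
      fun h => lt_max_of_lt_right (hM s k h)⟩
  have binder : ∀ {A : Formula L} (s : L.Srt), (∃ N, ∀ s k, A.HasFree s k → k < N) →
      ∃ N, ∀ s' k, A.HasFree s' (if s' = s then k + 1 else k) → k < N := by
    rintro A s ⟨N, hN⟩
    refine ⟨N, fun s' k h => ?_⟩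
    have := hN _ _ h
    split_ifs at this <;> omega
  induction A with
  | rel R ts =>
    choose N hN using fun i => (ts i).exists_hasVar_lt
    refine ⟨Finset.univ.sup N, ?_⟩
    rintro s' k ⟨i, hi⟩
    exact (hN i s' k hi).trans_le (Finset.le_sup (Finset.mem_univ i))
  | bot => exact ⟨0, fun _ _ h => h.elim⟩
  | top => exact ⟨0, fun _ _ h => h.elim⟩
  | and A B ihA ihB => exact binary ihA ihB
  | or A B ihA ihB => exact binary ihA ihB
  | imp A B ihA ihB => exact binary ihA ihB
  | all s A ih => exact binder s ih
  | ex s A ih => exact binder s ih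

end Substitution

/-! ### Structural properties of derivations -/

section Provability

variable {L : Signature}

theorem Provable.mono {Γ Δ : Set (Formula L)} {A : Formula L} (h : Provable Γ A) (hΓ : Γ ⊆ Δ) :
    Provable Δ A := by
  induction h generalizing Δ with
  | hyp h => exact .hyp (hΓ h)
  | impI _ ih => exact .impI (ih (Set.insert_subset_insert hΓ))
  | impE _ _ ih₁ ih₂ => exact .impE (ih₁ hΓ) (ih₂ hΓ)
  | andI _ _ ih₁ ih₂ => exact .andI (ih₁ hΓ) (ih₂ hΓ)
  | andE₁ _ ih => exact .andE₁ (ih hΓ)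
  | andE₂ _ ih => exact .andE₂ (ih hΓ)
  | orI₁ _ ih => exact .orI₁ (ih hΓ)
  | orI₂ _ ih => exact .orI₂ (ih hΓ)
  | orE _ _ _ ih ih₁ ih₂ =>
    exact .orE (ih hΓ) (ih₁ (Set.insert_subset_insert hΓ)) (ih₂ (Set.insert_subset_insert hΓ))
  | topI => exact .topI
  | botE _ ih => exact .botE (ih hΓ)
  | allI _ ih => exact .allI (ih (Set.image_mono hΓ))
  | allE t _ ih => exact .allE t (ih hΓ)
  | exI t _ ih => exact .exI t (ih hΓ)
  | exE _ _ ih₁ ih₂ =>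
    exact .exE (ih₁ hΓ) (ih₂ (Set.insert_subset_insert (Set.image_mono hΓ)))

theorem Provable.subst {Γ : Set (Formula L)} {A : Formula L} (h : Provable Γ A)
    (σ : (s : L.Srt) → ℕ → Term L s) : Provable (Formula.subst σ '' Γ) (A.subst σ) := by
  have shift_image : ∀ (s : L.Srt) (σ : (s : L.Srt) → ℕ → Term L s) (Γ : Set (Formula L)),
      Formula.subst (liftSub s σ) '' (Formula.shift s '' Γ) =
        Formula.shift s '' (Formula.subst σ '' Γ) := by
    intro s σ Γ
    simp only [Set.image_image, Formula.shift_subst_liftSub]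
  induction h generalizing σ with
  | hyp h => exact .hyp ⟨_, h, rfl⟩
  | impI _ ih => exact .impI (by simpa only [Set.image_insert_eq] using ih σ)
  | impE _ _ ih₁ ih₂ => exact .impE (ih₁ σ) (ih₂ σ)
  | andI _ _ ih₁ ih₂ => exact .andI (ih₁ σ) (ih₂ σ)
  | andE₁ _ ih => exact .andE₁ (ih σ)
  | andE₂ _ ih => exact .andE₂ (ih σ)
  | orI₁ _ ih => exact .orI₁ (ih σ)
  | orI₂ _ ih => exact .orI₂ (ih σ)
  | orE _ _ _ ih ih₁ ih₂ =>
    exact .orE (ih σ) (by simpa only [Set.image_insert_eq] using ih₁ σ)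
      (by simpa only [Set.image_insert_eq] using ih₂ σ)
  | topI => exact .topI
  | botE _ ih => exact .botE (ih σ)
  | @allI Γ s A _ ih => exact .allI (by simpa only [shift_image] using ih (liftSub s σ))
  | allE t _ ih =>
    rw [Formula.inst_subst]
    exact .allE _ (ih σ)
  | exI t _ ih =>
    refine .exI (t.subst σ) ?_
    rw [← Formula.inst_subst]
    exact ih σ
  | @exE Γ s A B _ _ ih₁ ih₂ =>
    refine .exE (ih₁ σ) ?_
    simpa only [Set.image_insert_eq, shift_image, Formula.shift_subst_liftSub]
      using ih₂ (liftSub s σ)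

/-- A set of propositions invariant under substitution, such as a set of closed ones. -/
def SubstClosed (T : Set (Formula L)) : Prop :=
  ∀ B ∈ T, ∀ σ : (s : L.Srt) → ℕ → Term L s, B.subst σ = B

theorem SubstClosed.image_subst {T : Set (Formula L)} (hT : SubstClosed T)
    (σ : (s : L.Srt) → ℕ → Term L s) : Formula.subst σ '' T = T := by
  ext B
  constructor
  · rintro ⟨B, hB, rfl⟩
    rwa [hT B hB]
  · exact fun hB => ⟨B, hB, hT B hB σ⟩

theorem SubstClosed.image_shift {T : Set (Formula L)} (hT : SubstClosed T) (s : L.Srt) :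
    Formula.shift s '' T = T :=
  hT.image_subst (shiftSub s)

/-- Generalization over a fresh variable. -/
theorem SubstClosed.provable_of_forall_inst {T : Set (Formula L)} (hT : SubstClosed T)
    {s : L.Srt} {A : Formula L} (h : ∀ t : Term L s, Provable T (A.inst t)) : Provable T A := by
  obtain ⟨N, hN⟩ := A.exists_hasFree_lt
  -- Instantiation turned index `0` into the fresh `N` and lowered the other indices of sort `s` by
  -- one. This renaming undoes it: `N` returns to `0` and all others go up.
  have key := (h (Term.var s N)).subst
    (Function.update Term.var s fun k => if k = N then Term.var s 0 else Term.var s (k + 1))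
  rw [hT.image_subst, Formula.inst, Formula.subst_subst] at key
  convert key using 1
  conv_lhs => rw [← Formula.subst_var A]
  refine Formula.subst_congr A (var_cases s ?_ ?_ ?_)
  · simp [Term.subst]
  · intro n hn
    have : n ≠ N := by have := hN _ _ hn; omega
    simp [Term.subst, this]
  · intro s' n hs _
    simp [scons_of_ne hs, Term.subst, hs]

end Provability

/-! ### Frame-valued semantics and soundness -/

/-- A model of a many-sorted language with truth values in `Ω`. -/
structure FrameModel (L : Signature) (Ω : Type) where
  Dom : L.Srt → Type
  fn : (f : L.Fn) → ((i : Fin (L.fnArity f)) → Dom (L.fnDom f i)) → Dom (L.fnCod f)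
  rel : (R : L.Rel) → ((i : Fin (L.relArity R)) → Dom (L.relDom R i)) → Ω

section Semantics

variable {L : Signature} {Ω : Type}

/-- The value of a term. -/
def Term.eval (M : FrameModel L Ω) (ρ : (s : L.Srt) → ℕ → M.Dom s) :
    {s : L.Srt} → Term L s → M.Dom s
  | _, .var s n => ρ s n
  | _, .app f ts => M.fn f fun i => (ts i).eval M ρ

variable (M : FrameModel L Ω)

theorem Term.eval_subst (σ : (s : L.Srt) → ℕ → Term L s) (ρ : (s : L.Srt) → ℕ → M.Dom s)
    {s : L.Srt} (t : Term L s) :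
    (t.subst σ).eval M ρ = t.eval M fun s n => (σ s n).eval M ρ := by
  induction t with
  | var => rfl
  | app f ts ih => simp only [Term.subst, Term.eval, ih]

theorem Term.eval_shift (s : L.Srt) (d : M.Dom s) (ρ : (s : L.Srt) → ℕ → M.Dom s)
    {s' : L.Srt} (t : Term L s') :
    (t.subst (shiftSub s)).eval M (scons s d ρ) = t.eval M ρ := by
  rw [Term.eval_subst]
  congr 1
  funext s' n
  by_cases h : s' = s
  · subst h
    simp [Term.eval]
  · simp [shiftSub_of_ne h, Term.eval, scons_of_ne h]

theorem Term.eval_congr {ρ ρ' : (s : L.Srt) → ℕ → M.Dom s} {s : L.Srt} (t : Term L s)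
    (h : ∀ s' k, t.HasVar s' k → ρ s' k = ρ' s' k) : t.eval M ρ = t.eval M ρ' := by
  induction t with
  | var s n => exact h s n ⟨rfl, rfl⟩
  | app f ts ih =>
    simp only [Term.eval]
    congr 1
    funext i
    exact ih i fun s' k hk => h s' k ⟨i, hk⟩

variable [Order.Frame Ω]

/-- The truth value of a proposition. -/
def Formula.eval (M : FrameModel L Ω) : Formula L → ((s : L.Srt) → ℕ → M.Dom s) → Ω
  | .rel R ts, ρ => M.rel R fun i => (ts i).eval M ρ
  | .bot, _ => ⊥
  | .top, _ => ⊤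
  | .and A B, ρ => A.eval M ρ ⊓ B.eval M ρ
  | .or A B, ρ => A.eval M ρ ⊔ B.eval M ρ
  | .imp A B, ρ => A.eval M ρ ⇨ B.eval M ρ
  | .all s A, ρ => ⨅ d, A.eval M (scons s d ρ)
  | .ex s A, ρ => ⨆ d, A.eval M (scons s d ρ)

/-- The proposition is true under every assignment. -/
def FrameModel.Valid (M : FrameModel L Ω) (A : Formula L) : Prop := ∀ ρ, A.eval M ρ = ⊤

theorem Formula.eval_subst (A : Formula L) (σ : (s : L.Srt) → ℕ → Term L s)
    (ρ : (s : L.Srt) → ℕ → M.Dom s) :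
    (A.subst σ).eval M ρ = A.eval M fun s n => (σ s n).eval M ρ := by
  have lift : ∀ (s : L.Srt) (d : M.Dom s) (σ : (s : L.Srt) → ℕ → Term L s)
      (ρ : (s : L.Srt) → ℕ → M.Dom s),
      (fun s' n => (liftSub s σ s' n).eval M (scons s d ρ)) =
        scons s d fun s' n => (σ s' n).eval M ρ := by
    intro s d σ ρ
    refine funext_var s ?_ ?_ ?_
    · simp [Term.eval]
    · simp [Term.eval_shift]
    · intro s' n h
      simp [liftSub_of_ne h, Term.eval_shift, scons_of_ne h]
  induction A generalizing σ ρ with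
  | rel R ts => simp only [Formula.subst, Formula.eval, Term.eval_subst]
  | bot => rfl
  | top => rfl
  | and A B ihA ihB => simp only [Formula.subst, Formula.eval, ihA, ihB]
  | or A B ihA ihB => simp only [Formula.subst, Formula.eval, ihA, ihB]
  | imp A B ihA ihB => simp only [Formula.subst, Formula.eval, ihA, ihB]
  | all s A ih => simp only [Formula.subst, Formula.eval, ih, lift]
  | ex s A ih => simp only [Formula.subst, Formula.eval, ih, lift]

@[simp] theorem Formula.eval_shift (A : Formula L) (s : L.Srt) (d : M.Dom s)
    (ρ : (s : L.Srt) → ℕ → M.Dom s) : (A.shift s).eval M (scons s d ρ) = A.eval M ρ := by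
  rw [Formula.shift, Formula.eval_subst]
  congr 1
  funext s' n
  exact Term.eval_shift M s d ρ (Term.var s' n)

theorem Formula.eval_inst (A : Formula L) {s : L.Srt} (t : Term L s)
    (ρ : (s : L.Srt) → ℕ → M.Dom s) :
    (A.inst t).eval M ρ = A.eval M (scons s (t.eval M ρ) ρ) := by
  rw [Formula.inst, Formula.eval_subst]
  congr 1
  refine funext_var s ?_ ?_ ?_
  · simp
  · simp [Term.eval]
  · intro s' n h
    simp [Term.eval, scons_of_ne h]

theorem Formula.eval_congr (A : Formula L) {ρ ρ' : (s : L.Srt) → ℕ → M.Dom s}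
    (h : ∀ s k, A.HasFree s k → ρ s k = ρ' s k) : A.eval M ρ = A.eval M ρ' := by
  have lift : ∀ {ρ ρ' : (s : L.Srt) → ℕ → M.Dom s} (s : L.Srt) (A : Formula L) (d : M.Dom s),
      (∀ s' k, A.HasFree s' (if s' = s then k + 1 else k) → ρ s' k = ρ' s' k) →
      ∀ s' k, A.HasFree s' k → scons s d ρ s' k = scons s d ρ' s' k := by
    intro ρ ρ' s A d h
    refine var_cases s ?_ ?_ ?_
    · simp
    · intro n hn
      simp [h s n (by simpa using hn)]
    · intro s' n hs hn
      simp [scons_of_ne hs, h s' n (by simpa [hs] using hn)]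
  induction A generalizing ρ ρ' with
  | rel R ts =>
    simp only [Formula.eval]
    congr 1
    funext i
    exact Term.eval_congr M _ fun s' k hk => h s' k ⟨i, hk⟩
  | bot => rfl
  | top => rfl
  | and A B ihA ihB =>
    simp only [Formula.eval, ihA fun s k hk => h s k (.inl hk),
      ihB fun s k hk => h s k (.inr hk)]
  | or A B ihA ihB =>
    simp only [Formula.eval, ihA fun s k hk => h s k (.inl hk),
      ihB fun s k hk => h s k (.inr hk)]
  | imp A B ihA ihB =>
    simp only [Formula.eval, ihA fun s k hk => h s k (.inl hk),
      ihB fun s k hk => h s k (.inr hk)]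
  | all s A ih => exact iInf_congr fun d => ih (lift s A d h)
  | ex s A ih => exact iSup_congr fun d => ih (lift s A d h)

theorem FrameModel.valid_all {A : Formula L} {s : L.Srt} :
    M.Valid (.all s A) ↔ M.Valid A := by
  constructor
  · intro h ρ
    -- Dropping the value at index `0` of sort `s` gives an assignment that becomes `ρ` again once
    -- `ρ s 0` is put in front.
    have h' : ⨅ d, A.eval M (scons s d (Function.update ρ s fun n => ρ s (n + 1))) = ⊤ := h _
    rw [iInf_eq_top] at h'
    rw [← h' (ρ s 0)]
    congr 1
    refine funext_var s ?_ ?_ ?_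
    · simp
    · simp
    · intro s' n h
      simp [scons_of_ne h, h]
  · intro h ρ
    exact iInf_eq_top.2 fun d => h _

theorem FrameModel.valid_alls {A : Formula L} {s : L.Srt} (n : ℕ) :
    M.Valid (.alls s n A) ↔ M.Valid A := by
  induction n generalizing A with
  | zero => rfl
  | succ n ih => rw [Formula.alls, ih, M.valid_all]

/-- Soundness: the infimum of the hypotheses is below the conclusion. -/
theorem Provable.le_eval {Γ : Set (Formula L)} {A : Formula L} (h : Provable Γ A)
    (ρ : (s : L.Srt) → ℕ → M.Dom s) (a : Ω) (ha : ∀ B ∈ Γ, a ≤ B.eval M ρ) :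
    a ≤ A.eval M ρ := by
  have insert_le : ∀ {Γ : Set (Formula L)} {ρ : (s : L.Srt) → ℕ → M.Dom s} {a : Ω}
      (A : Formula L), (∀ B ∈ Γ, a ≤ B.eval M ρ) →
      ∀ B ∈ insert A Γ, a ⊓ A.eval M ρ ≤ B.eval M ρ := by
    rintro Γ ρ a A h B (rfl | hB)
    · exact inf_le_right
    · exact inf_le_of_left_le (h B hB)
  have shift_le : ∀ {Γ : Set (Formula L)} {ρ : (s : L.Srt) → ℕ → M.Dom s} {a : Ω}
      (s : L.Srt) (d : M.Dom s), (∀ B ∈ Γ, a ≤ B.eval M ρ) →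
      ∀ B ∈ Formula.shift s '' Γ, a ≤ B.eval M (scons s d ρ) := by
    rintro Γ ρ a s d h _ ⟨B, hB, rfl⟩
    simpa using h B hB
  induction h generalizing ρ a with
  | hyp h => exact ha _ h
  | impI _ ih => exact le_himp_iff.2 (ih ρ _ (insert_le _ ha))
  | impE _ _ ih₁ ih₂ => exact (le_inf (ih₁ ρ a ha) (ih₂ ρ a ha)).trans himp_inf_le
  | andI _ _ ih₁ ih₂ => exact le_inf (ih₁ ρ a ha) (ih₂ ρ a ha)
  | andE₁ _ ih => exact (ih ρ a ha).trans inf_le_left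
  | andE₂ _ ih => exact (ih ρ a ha).trans inf_le_right
  | orI₁ _ ih => exact (ih ρ a ha).trans le_sup_left
  | orI₂ _ ih => exact (ih ρ a ha).trans le_sup_right
  | orE _ _ _ ih ih₁ ih₂ =>
    refine (le_inf le_rfl (ih ρ a ha)).trans ?_
    simp only [Formula.eval]
    rw [inf_sup_left]
    exact sup_le (ih₁ ρ _ (insert_le _ ha)) (ih₂ ρ _ (insert_le _ ha))
  | topI => exact le_top
  | botE _ ih => exact (ih ρ a ha).trans bot_le
  | allI _ ih => exact le_iInf fun d => ih _ a (shift_le _ d ha)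
  | allE t _ ih =>
    rw [Formula.eval_inst]
    exact (ih ρ a ha).trans (iInf_le _ _)
  | exI t _ ih =>
    have := ih ρ a ha
    rw [Formula.eval_inst] at this
    exact this.trans (le_iSup (fun d => Formula.eval M _ (scons _ d ρ)) _)
  | @exE Γ s A B _ _ ih₁ ih₂ =>
    refine (le_inf le_rfl (ih₁ ρ a ha)).trans ?_
    simp only [Formula.eval]
    -- The infinite distributive law of a frame is what makes existential elimination sound.
    rw [inf_iSup_eq]
    refine iSup_le fun d => ?_
    simpa using ih₂ (scons s d ρ) _ (insert_le _ (shift_le s d ha))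

theorem Provable.valid {T : Set (Formula L)} {A : Formula L} (h : Provable T A)
    (hT : ∀ B ∈ T, M.Valid B) : M.Valid A := fun ρ =>
  top_le_iff.1 (h.le_eval M ρ ⊤ fun B hB => (hT B hB ρ).ge)

end Semantics

/-! ### Completeness by the MacNeille completion -/

section Completeness

variable {L : Signature}

/-- `A` entails `B` in the theory `T`. -/
def Entails (T : Set (Formula L)) (A B : Formula L) : Prop := Provable T (A ⇒ₚ B)

namespace Entails

variable {T : Set (Formula L)} {A B C : Formula L}

theorem iff_insert : Entails T A B ↔ Provable (insert A T) B :=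
  ⟨fun h => .impE (Provable.mono h (Set.subset_insert _ _)) (.hyp (Set.mem_insert _ _)), .impI⟩

theorem refl (T : Set (Formula L)) (A : Formula L) : Entails T A A :=
  .impI (.hyp (Set.mem_insert _ _))

theorem trans (h₁ : Entails T A B) (h₂ : Entails T B C) : Entails T A C :=
  .impI <| .impE (Provable.mono h₂ (Set.subset_insert _ _)) (iff_insert.1 h₁)

theorem and_iff : Entails T C (A ∧ₚ B) ↔ Entails T C A ∧ Entails T C B := by
  simp only [iff_insert]
  exact ⟨fun h => ⟨.andE₁ h, .andE₂ h⟩, fun h => .andI h.1 h.2⟩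

theorem or_iff : Entails T (.or A B) C ↔ Entails T A C ∧ Entails T B C := by
  constructor
  · intro h
    exact ⟨trans (iff_insert.2 (.orI₁ (.hyp (Set.mem_insert _ _)))) h,
      trans (iff_insert.2 (.orI₂ (.hyp (Set.mem_insert _ _)))) h⟩
  · simp only [iff_insert]
    rintro ⟨hA, hB⟩
    exact .orE (.hyp (Set.mem_insert _ _))
      (hA.mono (Set.insert_subset_insert (Set.subset_insert _ _)))
      (hB.mono (Set.insert_subset_insert (Set.subset_insert _ _)))

theorem imp_iff : Entails T C (A ⇒ₚ B) ↔ Entails T (C ∧ₚ A) B := by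
  constructor
  · intro h
    have hC := (and_iff.1 (refl T (C ∧ₚ A)))
    exact iff_insert.2 (.impE (iff_insert.1 (trans hC.1 h)) (iff_insert.1 hC.2))
  · intro h
    refine .impI (.impI (.impE (Provable.mono h ?_)
      (.andI (.hyp (.inr (Set.mem_insert _ _))) (.hyp (Set.mem_insert _ _)))))
    exact (Set.subset_insert _ _).trans (Set.subset_insert _ _)

/-- The instance at a variable fresh for the propositions involved already gives the general case,
since renaming leaves `T` unchanged. Thus a universal proposition is the meet of its instances in
the entailment preorder. -/
theorem all_iff (hT : SubstClosed T) (s : L.Srt) (A : Formula L) :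
    Entails T C (.all s A) ↔ ∀ t : Term L s, Entails T C (A.inst t) := by
  constructor
  · intro h t
    exact iff_insert.2 (.allE t (iff_insert.1 h))
  · intro h
    have key : Entails T (C.shift s) A := by
      refine hT.provable_of_forall_inst (s := s) fun t => ?_
      have : (C.shift s ⇒ₚ A).inst t = (C ⇒ₚ A.inst t) :=
        congrArg (· ⇒ₚ A.inst t) (C.shift_inst s t)
      rw [this]
      exact h t
    refine iff_insert.2 (.allI ?_)
    rw [Set.image_insert_eq, hT.image_shift]
    exact iff_insert.1 key

theorem ex_iff (hT : SubstClosed T) (s : L.Srt) (A : Formula L) :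
    Entails T (.ex s A) C ↔ ∀ t : Term L s, Entails T (A.inst t) C := by
  constructor
  · intro h t
    exact trans (iff_insert.2 (.exI t (.hyp (Set.mem_insert _ _)))) h
  · intro h
    have key : Entails T A (C.shift s) := by
      refine hT.provable_of_forall_inst (s := s) fun t => ?_
      have : (A ⇒ₚ C.shift s).inst t = (A.inst t ⇒ₚ C) :=
        congrArg (A.inst t ⇒ₚ ·) (C.shift_inst s t)
      rw [this]
      exact h t
    refine iff_insert.2 (.exE (.hyp (Set.mem_insert _ _)) ?_)
    rw [Set.image_insert_eq, hT.image_shift]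
    exact (iff_insert.1 key).mono (Set.insert_subset_insert (Set.subset_insert _ _))

end Entails

/-- Propositions, to be preordered by entailment in the theory `T`. -/
structure Lindenbaum (T : Set (Formula L)) where
  toFormula : Formula L

instance (T : Set (Formula L)) : Preorder (Lindenbaum T) where
  le A B := Entails T A.toFormula B.toFormula
  le_refl A := .refl T A.toFormula
  le_trans _ _ _ := .trans

namespace Lindenbaum

variable {T : Set (Formula L)}

/-- The MacNeille completion of the Lindenbaum preorder is a complete Heyting algebra. -/
instance : Order.Frame (DedekindCut (Lindenbaum T)) :=
  .ofMinimalAxioms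
    { (inferInstance : CompleteLattice (DedekindCut (Lindenbaum T))) with
      inf_sSup_le_iSup_inf := by
        intro a S x hx
        change x ∈ DedekindCut.left _
        rw [← DedekindCut.lowerBounds_right]
        -- A cut consists of the lower bounds of its upper set, so it is enough to place `x` below
        -- each upper bound `U`.
        intro U hU
        have hxa : DedekindCut.principal x ≤ a ⊓ sSup S := DedekindCut.principal_le_iff.2 hx
        -- Implication is needed only between propositions: for `y` in a member `b` of `S`, the
        -- conjunction of `y` and `x` lies in `a ⊓ b`, hence below `U`, so `y` entails `x ⇒ U`.
        have hS : sSup S ≤ DedekindCut.principal ⟨x.toFormula ⇒ₚ U.toFormula⟩ := by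
          refine sSup_le fun b hb => ?_
          intro y hy
          change Entails T y.toFormula (x.toFormula ⇒ₚ U.toFormula)
          rw [Entails.imp_iff]
          have hle : a ⊓ b ≤ DedekindCut.principal U :=
            (le_iSup₂ (f := fun b _ => a ⊓ b) b hb).trans (DedekindCut.le_principal_iff.2 hU)
          have hyx := Entails.and_iff.1 (.refl T (y.toFormula ∧ₚ x.toFormula))
          refine DedekindCut.principal_le_principal (a := ⟨y.toFormula ∧ₚ x.toFormula⟩).1
            (le_trans (le_inf ?_ ?_) hle)
          · exact (DedekindCut.principal_le_principal.2 hyx.2).trans (hxa.trans inf_le_left)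
          · exact (DedekindCut.principal_le_principal.2 hyx.1).trans
              (DedekindCut.principal_le_iff.2 hy)
        have hxU : Entails T x.toFormula (x.toFormula ⇒ₚ U.toFormula) :=
          DedekindCut.principal_le_principal.1 ((hxa.trans inf_le_right).trans hS)
        -- Contraction: `x` entails `x ⇒ U`, hence `U`.
        exact .trans (Entails.and_iff.2 ⟨.refl T _, .refl T _⟩) (Entails.imp_iff.1 hxU) }

/-- The truth value of a proposition in the completion. -/
def cut (T : Set (Formula L)) (A : Formula L) : DedekindCut (Lindenbaum T) :=
  DedekindCut.principal ⟨A⟩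

theorem cut_le_cut {A B : Formula L} :
    cut T A ≤ cut T B ↔ Entails T A B :=
  DedekindCut.principal_le_principal

/-- Principal cuts are join-dense, and dually meet-dense. Meets and implications are therefore
identified by testing from below, joins by testing from above, and in both cases the test is a
statement about entailment. -/
theorem le_of_forall_cut_le {a b : DedekindCut (Lindenbaum T)}
    (h : ∀ C, cut T C ≤ a → cut T C ≤ b) : a ≤ b := fun C hC =>
  DedekindCut.principal_le_iff.1 (h C.toFormula (DedekindCut.principal_le_iff.2 hC))

theorem le_of_forall_le_cut {a b : DedekindCut (Lindenbaum T)}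
    (h : ∀ C, b ≤ cut T C → a ≤ cut T C) : a ≤ b := by
  intro x hx
  change x ∈ DedekindCut.left _
  rw [← DedekindCut.lowerBounds_right]
  intro U hU
  have := h U.toFormula (DedekindCut.le_principal_iff.2 hU)
  exact DedekindCut.principal_le_principal.1
    ((DedekindCut.principal_le_iff.2 hx).trans this)

theorem eq_of_forall_cut_le {a b : DedekindCut (Lindenbaum T)}
    (h : ∀ C, cut T C ≤ a ↔ cut T C ≤ b) : a = b :=
  le_antisymm (le_of_forall_cut_le fun C => (h C).1) (le_of_forall_cut_le fun C => (h C).2)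

theorem eq_of_forall_le_cut {a b : DedekindCut (Lindenbaum T)}
    (h : ∀ C, a ≤ cut T C ↔ b ≤ cut T C) : a = b :=
  le_antisymm (le_of_forall_le_cut fun C => (h C).2) (le_of_forall_le_cut fun C => (h C).1)

theorem cut_eq_top {A : Formula L} : cut T A = ⊤ ↔ Provable T A := by
  constructor
  · intro h
    have : cut T .top ≤ cut T A := h ▸ le_top
    exact .impE (cut_le_cut.1 this) .topI
  · intro h
    refine eq_of_forall_cut_le fun C => iff_of_true (cut_le_cut.2 ?_) le_top
    exact .impI (h.mono (Set.subset_insert _ _))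

theorem cut_bot : cut T .bot = ⊥ :=
  eq_of_forall_le_cut fun _ => iff_of_true
    (cut_le_cut.2 (.impI (.botE (.hyp (Set.mem_insert _ _))))) bot_le

theorem cut_and (A B : Formula L) : cut T (A.and B) = cut T A ⊓ cut T B :=
  eq_of_forall_cut_le fun C => by
    rw [le_inf_iff]
    simp only [cut_le_cut]
    exact Entails.and_iff

theorem cut_or (A B : Formula L) : cut T (A.or B) = cut T A ⊔ cut T B :=
  eq_of_forall_le_cut fun C => by
    rw [sup_le_iff]
    simp only [cut_le_cut]
    exact Entails.or_iff

theorem cut_imp (A B : Formula L) : cut T (A.imp B) = cut T A ⇨ cut T B :=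
  eq_of_forall_cut_le fun C => by
    rw [le_himp_iff, ← cut_and]
    simp only [cut_le_cut]
    exact Entails.imp_iff

theorem cut_all (hT : SubstClosed T) (s : L.Srt) (A : Formula L) :
    cut T (.all s A) = ⨅ t : Term L s, cut T (A.inst t) :=
  eq_of_forall_cut_le fun C => by
    rw [le_iInf_iff]
    simp only [cut_le_cut]
    exact Entails.all_iff hT s A

theorem cut_ex (hT : SubstClosed T) (s : L.Srt) (A : Formula L) :
    cut T (.ex s A) = ⨆ t : Term L s, cut T (A.inst t) :=
  eq_of_forall_le_cut fun C => by
    rw [iSup_le_iff]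
    simp only [cut_le_cut]
    exact Entails.ex_iff hT s A

/-- The model made of the terms. -/
def termModel (T : Set (Formula L)) : FrameModel L (DedekindCut (Lindenbaum T)) where
  Dom := Term L
  fn := .app
  rel R ts := cut T (.rel R ts)

theorem term_eval (ρ : (s : L.Srt) → ℕ → Term L s) {s : L.Srt} (t : Term L s) :
    t.eval (termModel T) ρ = t.subst ρ := by
  induction t with
  | var => rfl
  | app f ts ih => simp only [Term.eval, Term.subst, ih]; rfl

/-- The truth lemma. An assignment of terms is a substitution, and the quantifiers of the model
range over the same terms as the instances in `cut_all` and `cut_ex`. -/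
theorem formula_eval (hT : SubstClosed T) (A : Formula L) (ρ : (s : L.Srt) → ℕ → Term L s) :
    A.eval (termModel T) ρ = cut T (A.subst ρ) := by
  induction A generalizing ρ with
  | rel R ts => simp only [Formula.eval, term_eval]; rfl
  | bot => exact cut_bot.symm
  | top => exact (cut_eq_top.2 .topI).symm
  | and A B ihA ihB => simp only [Formula.eval, Formula.subst, ihA, ihB, cut_and]
  | or A B ihA ihB => simp only [Formula.eval, Formula.subst, ihA, ihB, cut_or]
  | imp A B ihA ihB => simp only [Formula.eval, Formula.subst, ihA, ihB, cut_imp]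
  | all s A ih =>
    simp only [Formula.subst, cut_all hT, Formula.liftSub_subst_inst]
    exact iInf_congr fun d => ih _
  | ex s A ih =>
    simp only [Formula.subst, cut_ex hT, Formula.liftSub_subst_inst]
    exact iSup_congr fun d => ih _

end Lindenbaum

/-- Completeness of frame-valued models, for theories invariant under substitution. -/
theorem SubstClosed.provable_of_forall_valid {T : Set (Formula L)} (hT : SubstClosed T)
    {A : Formula L} (h : ∀ (Ω : Type) [Order.Frame Ω] (M : FrameModel L Ω),
      (∀ B ∈ T, M.Valid B) → M.Valid A) : Provable T A := by
  have key := h _ (Lindenbaum.termModel T) (fun B hB ρ => by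
    refine (Lindenbaum.formula_eval hT B ρ).trans ?_
    rw [hT B hB ρ]
    exact Lindenbaum.cut_eq_top.2 (.hyp hB)) Term.var
  have key' := (Lindenbaum.formula_eval hT A Term.var).symm.trans key
  rwa [Formula.subst_var, Lindenbaum.cut_eq_top] at key'

end Completeness

/-! ### Invariance of the two theories under substitution -/

section Closed

variable {L : Signature}

theorem Formula.alls_subst (s : L.Srt) (n : ℕ) (A : Formula L)
    (σ : (s : L.Srt) → ℕ → Term L s) :
    (Formula.alls s n A).subst σ = .alls s n (A.subst ((liftSub s)^[n] σ)) := by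
  induction n generalizing A with
  | zero => rfl
  | succ n ih => rw [Formula.alls, ih, Function.iterate_succ_apply']; rfl

theorem liftSub_iterate_of_lt (s : L.Srt) (σ : (s : L.Srt) → ℕ → Term L s) {n k : ℕ}
    (h : k < n) : (liftSub s)^[n] σ s k = Term.var s k := by
  induction n generalizing k with
  | zero => omega
  | succ n ih =>
    rw [Function.iterate_succ_apply']
    cases k with
    | zero => simp
    | succ k => simp [ih (Nat.lt_of_succ_lt_succ h), Term.subst]

/-- A closure by quantifiers over the variables `var s 0, …, var s (n - 1)` is invariant under
substitution if its matrix has no other variables. -/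
theorem Formula.alls_subst_eq_self (s : L.Srt) (n : ℕ) (A : Formula L)
    (h : ∀ τ : (s : L.Srt) → ℕ → Term L s, (∀ k < n, τ s k = Term.var s k) → A.subst τ = A)
    (σ : (s : L.Srt) → ℕ → Term L s) :
    (Formula.alls s n A).subst σ = .alls s n A := by
  rw [Formula.alls_subst, h _ fun k hk => liftSub_iterate_of_lt s σ hk]

end Closed

namespace HAN

section Subst

variable (σ : (s : Unit) → ℕ → Term lang s)

@[simp] theorem zero_subst : zero.subst σ = zero := by
  simp only [zero, Term.subst]
  congr 1
  funext i
  exact i.elim0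

@[simp] theorem succ_subst (t : Term lang ()) : (succ t).subst σ = succ (t.subst σ) := by
  simp only [succ, Term.subst]
  congr 1
  funext i
  fin_cases i
  rfl

@[simp] theorem pred_subst (t : Term lang ()) : (pred t).subst σ = pred (t.subst σ) := by
  simp only [pred, Term.subst]
  congr 1
  funext i
  fin_cases i
  rfl

@[simp] theorem add_subst (t u : Term lang ()) :
    (add t u).subst σ = add (t.subst σ) (u.subst σ) := by
  simp only [add, Term.subst]
  congr 1
  funext i
  fin_cases i <;> rfl

@[simp] theorem mul_subst (t u : Term lang ()) :
    (mul t u).subst σ = mul (t.subst σ) (u.subst σ) := by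
  simp only [mul, Term.subst]
  congr 1
  funext i
  fin_cases i <;> rfl

@[simp] theorem eq_subst (t u : Term lang ()) :
    (eq t u).subst σ = eq (t.subst σ) (u.subst σ) := by
  simp only [eq, Formula.subst]
  congr 1
  funext i
  fin_cases i <;> rfl

@[simp] theorem null_subst (t : Term lang ()) : (null t).subst σ = null (t.subst σ) := by
  simp only [null, Formula.subst]
  congr 1
  funext i
  fin_cases i
  rfl

@[simp] theorem nat_subst (t : Term lang ()) : (nat t).subst σ = nat (t.subst σ) := by
  simp only [nat, Formula.subst]
  congr 1
  funext i
  fin_cases i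
  rfl

@[simp] theorem all_subst (A : Formula lang) :
    (all A).subst σ = all (A.subst (liftSub () σ)) := rfl

end Subst

theorem substClosed_theory : SubstClosed Theory := by
  intro B hB σ
  cases hB with
  | induction n P hP =>
    refine Formula.alls_subst_eq_self (L := lang) () n _ (fun τ hτ => ?_) σ
    -- The parameters of `P` have indices `1, …, n`; outside the induction variable these are `0, …,
    -- n - 1`, precisely the indices fixed by `τ`.
    have h0 : (P.inst zero).subst τ = P.inst zero := by
      rw [Formula.inst_subst, zero_subst]
      congr 1
      conv_rhs => rw [← Formula.subst_var P]
      refine Formula.subst_congr P fun s k hk => ?_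
      cases k with
      | zero => rfl
      | succ k =>
        have := hP _ hk
        rw [show s = () from rfl, liftSub_succ, hτ k (by omega)]
        rfl
    have h1 : P.subst (liftSub (L := lang) () τ) = P := by
      conv_rhs => rw [← Formula.subst_var P]
      refine Formula.subst_congr P fun s k hk => ?_
      cases k with
      | zero => rfl
      | succ k =>
        have := hP _ hk
        rw [show s = () from rfl, liftSub_succ, hτ k (by omega)]
        rfl
    have h2 : (succInst P).subst (liftSub (L := lang) () τ) = succInst P := by
      rw [succInst, Formula.subst_subst]
      refine Formula.subst_congr P fun s k hk => ?_
      cases k with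
      | zero => simp [v, Term.subst]
      | succ k =>
        have := hP _ hk
        simp only [v, Term.subst, liftSub_succ]
        rw [hτ k (by omega)]
        rfl
    simp only [Formula.subst, all_subst, nat_subst, v, Term.subst, liftSub_zero, h0, h1, h2]
  | _ => simp [Formula.subst, Formula.neg, v, Term.subst]

end HAN

namespace HAClass

section Subst

variable (σ : (s : Srt) → ℕ → Term lang s)

@[simp] theorem zero_subst : zero.subst σ = zero := by
  simp only [zero, Term.subst]
  congr 1
  funext i
  exact i.elim0

@[simp] theorem succ_subst (t : Term lang Srt.ι) : (succ t).subst σ = succ (t.subst σ) := by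
  simp only [succ, Term.subst]
  congr 1
  funext i
  fin_cases i
  rfl

@[simp] theorem pred_subst (t : Term lang Srt.ι) : (pred t).subst σ = pred (t.subst σ) := by
  simp only [pred, Term.subst]
  congr 1
  funext i
  fin_cases i
  rfl

@[simp] theorem add_subst (t u : Term lang Srt.ι) :
    (add t u).subst σ = add (t.subst σ) (u.subst σ) := by
  simp only [add, Term.subst]
  congr 1
  funext i
  fin_cases i <;> rfl

@[simp] theorem mul_subst (t u : Term lang Srt.ι) :
    (mul t u).subst σ = mul (t.subst σ) (u.subst σ) := by
  simp only [mul, Term.subst]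
  congr 1
  funext i
  fin_cases i <;> rfl

@[simp] theorem eq_subst (t u : Term lang Srt.ι) :
    (eq t u).subst σ = eq (t.subst σ) (u.subst σ) := by
  simp only [eq, Formula.subst]
  congr 1
  funext i
  fin_cases i <;> rfl

@[simp] theorem null_subst (t : Term lang Srt.ι) : (null t).subst σ = null (t.subst σ) := by
  simp only [null, Formula.subst]
  congr 1
  funext i
  fin_cases i
  rfl

@[simp] theorem nat_subst (t : Term lang Srt.ι) : (nat t).subst σ = nat (t.subst σ) := by
  simp only [nat, Formula.subst]
  congr 1
  funext i
  fin_cases i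
  rfl

@[simp] theorem mem_subst (t : Term lang Srt.ι) (p : Term lang Srt.κ) :
    (mem t p).subst σ = mem (t.subst σ) (p.subst σ) := by
  simp only [mem, Formula.subst]
  congr 1
  funext i
  fin_cases i <;> rfl

@[simp] theorem all_subst (A : Formula lang) :
    (all A).subst σ = all (A.subst (liftSub Srt.ι σ)) := rfl

@[simp] theorem allC_subst (A : Formula lang) :
    (allC A).subst σ = allC (A.subst (liftSub Srt.κ σ)) := rfl

@[simp] theorem liftSub_κ_ι (n : ℕ) : liftSub (L := lang) Srt.κ σ Srt.ι n =
    (σ Srt.ι n).subst (shiftSub (L := lang) Srt.κ) := rfl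

@[simp] theorem liftSub_ι_κ (n : ℕ) : liftSub (L := lang) Srt.ι σ Srt.κ n =
    (σ Srt.κ n).subst (shiftSub (L := lang) Srt.ι) := rfl

@[simp] theorem shiftSub_κ_ι (n : ℕ) :
    shiftSub (L := lang) Srt.κ Srt.ι n = Term.var (L := lang) Srt.ι n := rfl

@[simp] theorem shiftSub_ι_κ (n : ℕ) :
    shiftSub (L := lang) Srt.ι Srt.κ n = Term.var (L := lang) Srt.κ n := rfl

theorem ofTerm_subst_eq_self {s : HAN.lang.Srt} (t : Term HAN.lang s)
    (h : ∀ k, t.HasVar () k → σ Srt.ι k = v k) : (ofTerm t).subst σ = ofTerm t := by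
  induction t with
  | var s n => exact h n ⟨rfl, rfl⟩
  | app f ts ih =>
    have ih' := fun i => ih i fun k hk => h k ⟨i, hk⟩
    cases f <;> simp [ofTerm, ih']

theorem ofFormula_subst_eq_self (P : Formula HAN.lang)
    (h : ∀ k, P.HasFree () k → σ Srt.ι k = v k) : (ofFormula P).subst σ = ofFormula P := by
  have lift : ∀ {σ : (s : Srt) → ℕ → Term lang s} (A : Formula HAN.lang),
      (∀ k, A.HasFree () (k + 1) → σ Srt.ι k = v k) →
      ∀ k, A.HasFree () k → liftSub (L := lang) Srt.ι σ Srt.ι k = v k := by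
    intro σ A h k hk
    cases k with
    | zero => rfl
    | succ k => simp [h k hk, v, Term.subst]
  induction P generalizing σ with
  | rel R ts =>
    have ht := fun i => ofTerm_subst_eq_self σ (ts i) fun k hk => h k ⟨i, hk⟩
    cases R <;> simp [ofFormula, ht]
  | bot => rfl
  | top => rfl
  | and A B ihA ihB =>
    simp only [ofFormula, Formula.subst, ihA σ fun k hk => h k (.inl hk),
      ihB σ fun k hk => h k (.inr hk)]
  | or A B ihA ihB =>
    simp only [ofFormula, Formula.subst, ihA σ fun k hk => h k (.inl hk),
      ihB σ fun k hk => h k (.inr hk)]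
  | imp A B ihA ihB =>
    simp only [ofFormula, Formula.subst, ihA σ fun k hk => h k (.inl hk),
      ihB σ fun k hk => h k (.inr hk)]
  | all s A ih => simp only [ofFormula, Formula.subst, ih _ (lift A h)]
  | ex s A ih => simp only [ofFormula, Formula.subst, ih _ (lift A h)]

end Subst

theorem substClosed_theory : SubstClosed Theory := by
  intro B hB σ
  cases hB with
  | mem_cls n P hP =>
    refine Formula.alls_subst_eq_self (L := lang) Srt.ι (n + 1) _ (fun τ hτ => ?_) σ
    have h0 : (ofFormula P).subst τ = ofFormula P :=
      ofFormula_subst_eq_self τ P fun k hk => hτ k (hP k hk)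
    have h1 : (cls n P hP fun i => v (i + 1)).subst τ = cls n P hP fun i => v (i + 1) := by
      simp only [cls, Term.subst]
      congr 1
      funext i
      exact hτ (i + 1) (by have := i.2; omega)
    have h2 : (v 0).subst τ = v 0 := hτ 0 (by omega)
    simp only [Formula.iff, Formula.subst, mem_subst, h0, h1, h2]
  | _ => simp [Formula.subst, Formula.neg, Formula.iff, v, c, Term.subst]

end HAClass

/-- Turns each biconditional axiom of `HA_Class` into an equation between truth values. -/
theorem Formula.eval_iff_eq_top {L : Signature} {Ω : Type} [Order.Frame Ω] (M : FrameModel L Ω)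
    (A B : Formula L) (ρ : (s : L.Srt) → ℕ → M.Dom s) :
    (A ⇔ₚ B).eval M ρ = ⊤ ↔ A.eval M ρ = B.eval M ρ := by
  simp only [Formula.iff, Formula.eval, inf_eq_top_iff, himp_eq_top_iff]
  exact le_antisymm_iff.symm

/-! ### Models of `HA_N`: equality as a congruence, induction -/

namespace HAN

section Values

variable {Ω : Type} (M : FrameModel lang Ω)

def zeroVal : M.Dom () := M.fn Fn.zero fun i => i.elim0
def succVal (a : M.Dom ()) : M.Dom () := M.fn Fn.succ ![a]
def predVal (a : M.Dom ()) : M.Dom () := M.fn Fn.pred ![a]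
def addVal (a b : M.Dom ()) : M.Dom () := M.fn Fn.add ![a, b]
def mulVal (a b : M.Dom ()) : M.Dom () := M.fn Fn.mul ![a, b]
def eqVal (a b : M.Dom ()) : Ω := M.rel Rel.eq ![a, b]
def nullVal (a : M.Dom ()) : Ω := M.rel Rel.null ![a]
def natVal (a : M.Dom ()) : Ω := M.rel Rel.nat ![a]

theorem fn_zero (ts : Fin 0 → M.Dom ()) : M.fn Fn.zero ts = zeroVal M :=
  congrArg (M.fn Fn.zero) (funext fun i => i.elim0)

theorem fn_succ (ts : Fin 1 → M.Dom ()) : M.fn Fn.succ ts = succVal M (ts 0) :=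
  congrArg (M.fn Fn.succ) (funext fun i => by fin_cases i; rfl)

theorem fn_pred (ts : Fin 1 → M.Dom ()) : M.fn Fn.pred ts = predVal M (ts 0) :=
  congrArg (M.fn Fn.pred) (funext fun i => by fin_cases i; rfl)

theorem fn_add (ts : Fin 2 → M.Dom ()) : M.fn Fn.add ts = addVal M (ts 0) (ts 1) :=
  congrArg (M.fn Fn.add) (funext fun i => by fin_cases i <;> rfl)

theorem fn_mul (ts : Fin 2 → M.Dom ()) : M.fn Fn.mul ts = mulVal M (ts 0) (ts 1) :=
  congrArg (M.fn Fn.mul) (funext fun i => by fin_cases i <;> rfl)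

theorem rel_eq (ts : Fin 2 → M.Dom ()) : M.rel Rel.eq ts = eqVal M (ts 0) (ts 1) :=
  congrArg (M.rel Rel.eq) (funext fun i => by fin_cases i <;> rfl)

theorem rel_null (ts : Fin 1 → M.Dom ()) : M.rel Rel.null ts = nullVal M (ts 0) :=
  congrArg (M.rel Rel.null) (funext fun i => by fin_cases i; rfl)

theorem rel_nat (ts : Fin 1 → M.Dom ()) : M.rel Rel.nat ts = natVal M (ts 0) :=
  congrArg (M.rel Rel.nat) (funext fun i => by fin_cases i; rfl)

variable (ρ : (s : lang.Srt) → ℕ → M.Dom s)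

@[simp] theorem eval_v (n : ℕ) : (v n).eval M ρ = ρ () n := rfl

@[simp] theorem eval_zero : zero.eval M ρ = zeroVal M := fn_zero M _

@[simp] theorem eval_succ (t : Term lang ()) :
    (succ t).eval M ρ = succVal M (t.eval M ρ) := fn_succ M _

@[simp] theorem eval_pred (t : Term lang ()) :
    (pred t).eval M ρ = predVal M (t.eval M ρ) := fn_pred M _

@[simp] theorem eval_add (t u : Term lang ()) :
    (add t u).eval M ρ = addVal M (t.eval M ρ) (u.eval M ρ) := fn_add M _

@[simp] theorem eval_mul (t u : Term lang ()) :
    (mul t u).eval M ρ = mulVal M (t.eval M ρ) (u.eval M ρ) := fn_mul M _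

variable [Order.Frame Ω]

@[simp] theorem eval_eq (t u : Term lang ()) :
    (eq t u).eval M ρ = eqVal M (t.eval M ρ) (u.eval M ρ) := rel_eq M _

@[simp] theorem eval_null (t : Term lang ()) :
    (null t).eval M ρ = nullVal M (t.eval M ρ) := rel_null M _

@[simp] theorem eval_nat (t : Term lang ()) :
    (nat t).eval M ρ = natVal M (t.eval M ρ) := rel_nat M _

theorem eval_all (A : Formula lang) :
    (all A).eval M ρ = ⨅ d, A.eval M (scons (S := lang.Srt) () d ρ) := rfl

theorem eval_succInst (P : Formula lang) (d : M.Dom ()) :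
    (succInst P).eval M (scons (S := lang.Srt) () d ρ) =
      P.eval M (scons (S := lang.Srt) () (succVal M d) ρ) := by
  rw [succInst, Formula.eval_subst]
  congr 1
  funext s n
  cases n with
  | zero => simp
  | succ n => simp

end Values

section Models

variable {Ω : Type} [Order.Frame Ω] {M : FrameModel lang Ω} (hM : ∀ B ∈ Theory, M.Valid B)

include hM

theorem eqVal_refl (a : M.Dom ()) : eqVal M a a = ⊤ := by
  simpa using M.valid_all.1 (hM _ .eq_refl) fun _ _ => a

theorem eqVal_symm (a b : M.Dom ()) : eqVal M a b ≤ eqVal M b a := by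
  -- The innermost quantified variable has index `0`, so the values are listed from the last
  -- variable to the first.
  simpa [Formula.eval] using M.valid_all.1 (M.valid_all.1 (hM _ .eq_symm))
    fun _ k => if k = 0 then b else a

theorem eqVal_trans (a b d : M.Dom ()) : eqVal M a b ⊓ eqVal M b d ≤ eqVal M a d := by
  simpa [Formula.eval] using M.valid_all.1 (M.valid_all.1 (M.valid_all.1 (hM _ .eq_trans)))
    fun _ k => if k = 0 then d else if k = 1 then b else a

theorem eqVal_succ (a b : M.Dom ()) :
    eqVal M a b ≤ eqVal M (succVal M a) (succVal M b) := by
  simpa [Formula.eval] using M.valid_all.1 (M.valid_all.1 (hM _ .eq_succ))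
    fun _ k => if k = 0 then b else a

theorem eqVal_pred (a b : M.Dom ()) :
    eqVal M a b ≤ eqVal M (predVal M a) (predVal M b) := by
  simpa [Formula.eval] using M.valid_all.1 (M.valid_all.1 (hM _ .eq_pred))
    fun _ k => if k = 0 then b else a

theorem eqVal_add (a b a' b' : M.Dom ()) :
    eqVal M a b ⊓ eqVal M a' b' ≤ eqVal M (addVal M a a') (addVal M b b') := by
  simpa [Formula.eval] using
    M.valid_all.1 (M.valid_all.1 (M.valid_all.1 (M.valid_all.1 (hM _ .eq_add))))
      fun _ k => if k = 0 then b' else if k = 1 then a' else if k = 2 then b else a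

theorem eqVal_mul (a b a' b' : M.Dom ()) :
    eqVal M a b ⊓ eqVal M a' b' ≤ eqVal M (mulVal M a a') (mulVal M b b') := by
  simpa [Formula.eval] using
    M.valid_all.1 (M.valid_all.1 (M.valid_all.1 (M.valid_all.1 (hM _ .eq_mul))))
      fun _ k => if k = 0 then b' else if k = 1 then a' else if k = 2 then b else a

theorem eqVal_null (a b : M.Dom ()) : eqVal M a b ⊓ nullVal M a ≤ nullVal M b := by
  simpa [Formula.eval] using M.valid_all.1 (M.valid_all.1 (hM _ .eq_null))
    fun _ k => if k = 0 then b else a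

theorem eqVal_nat (a b : M.Dom ()) : eqVal M a b ⊓ natVal M a ≤ natVal M b := by
  simpa [Formula.eval] using M.valid_all.1 (M.valid_all.1 (hM _ .eq_nat))
    fun _ k => if k = 0 then b else a

theorem natVal_zero : natVal M (zeroVal M) = ⊤ := by
  simpa using hM _ .nat_zero fun _ _ => zeroVal M

theorem natVal_succ (a : M.Dom ()) : natVal M a ≤ natVal M (succVal M a) := by
  simpa [Formula.eval] using M.valid_all.1 (hM _ .nat_succ) fun _ _ => a

/-- A bound on the free variables of `P` selects an axiom of the schema; validity of its closure
allows arbitrary parameter values `ρ`. -/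
theorem eval_induction (P : Formula lang) (ρ : (s : lang.Srt) → ℕ → M.Dom s) (a : M.Dom ()) :
    P.eval M (scons () (zeroVal M) ρ) ⊓
      (⨅ d, natVal M d ⇨ P.eval M (scons () d ρ) ⇨ P.eval M (scons () (succVal M d) ρ)) ⊓
      natVal M a ≤ P.eval M (scons () a ρ) := by
  obtain ⟨n, hn⟩ := P.exists_hasFree_lt
  have h := (M.valid_alls n).1
    (hM _ (.induction n P fun k hk => (hn () k hk).trans (Nat.lt_succ_self n))) ρ
  simp only [Formula.eval, eval_all, Formula.eval_inst, eval_zero, eval_nat, eval_v, scons_zero,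
    himp_eq_top_iff, le_himp_iff, le_iInf_iff] at h
  refine (inf_le_inf_right _ (inf_le_inf_left _ (iInf_mono fun d => ?_))).trans (h a)
  exact himp_le_himp_left (himp_le_himp_left (eval_succInst M ρ P d).ge)

/-- The truth value `c` serves as a hypothesis under which the two assignments are equal, so
congruence is obtained inside the logic and not just for equations of value `⊤`. -/
theorem eqVal_term {σ τ : (s : lang.Srt) → ℕ → M.Dom s} {c : Ω}
    (h : ∀ k, c ≤ eqVal M (σ () k) (τ () k)) {s : lang.Srt} (t : Term lang s) :
    c ≤ eqVal M (t.eval M σ) (t.eval M τ) := by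
  induction t with
  | var s n => exact h n
  | app f ts ih =>
    simp only [Term.eval]
    cases f with
    | zero =>
      rw [fn_zero, fn_zero, eqVal_refl hM]
      exact le_top
    | succ =>
      rw [fn_succ, fn_succ]
      exact (ih 0).trans (eqVal_succ hM _ _)
    | pred =>
      rw [fn_pred, fn_pred]
      exact (ih 0).trans (eqVal_pred hM _ _)
    | add =>
      rw [fn_add, fn_add]
      exact (le_inf (ih 0) (ih 1)).trans (eqVal_add hM _ _ _ _)
    | mul =>
      rw [fn_mul, fn_mul]
      exact (le_inf (ih 0) (ih 1)).trans (eqVal_mul hM _ _ _ _)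

/-- Equal assignments give equivalent truth values. -/
theorem eval_of_eqVal (P : Formula lang) {σ τ : (s : lang.Srt) → ℕ → M.Dom s} {c : Ω}
    (h : ∀ k, c ≤ eqVal M (σ () k) (τ () k)) : c ⊓ P.eval M σ ≤ P.eval M τ := by
  have lift : ∀ {σ τ : (s : lang.Srt) → ℕ → M.Dom s} (d : M.Dom ()),
      (∀ k, c ≤ eqVal M (σ () k) (τ () k)) →
      ∀ k, c ≤ eqVal M (scons () d σ () k) (scons () d τ () k) := by
    intro σ τ d h k
    cases k with
    | zero => simp [eqVal_refl hM]
    | succ k => simpa using h k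
  induction P generalizing σ τ with
  | rel R ts =>
    have ht := fun i => eqVal_term hM h (ts i)
    simp only [Formula.eval]
    cases R with
    | eq =>
      rw [rel_eq, rel_eq]
      refine (le_inf (le_inf ((inf_le_left.trans (ht 0)).trans (eqVal_symm hM _ _))
        inf_le_right) (inf_le_left.trans (ht 1))).trans ?_
      exact (inf_le_inf_right _ (eqVal_trans hM _ _ _)).trans (eqVal_trans hM _ _ _)
    | null =>
      rw [rel_null, rel_null]
      exact (inf_le_inf_right _ (ht 0)).trans (eqVal_null hM _ _)
    | nat =>
      rw [rel_nat, rel_nat]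
      exact (inf_le_inf_right _ (ht 0)).trans (eqVal_nat hM _ _)
  | bot => exact inf_le_right
  | top => exact le_top
  | and A B ihA ihB =>
    exact le_inf ((inf_le_inf_left c inf_le_left).trans (ihA h))
      ((inf_le_inf_left c inf_le_right).trans (ihB h))
  | or A B ihA ihB =>
    simp only [Formula.eval, inf_sup_left]
    exact sup_le_sup (ihA h) (ihB h)
  | imp A B ihA ihB =>
    -- The antecedent is carried from `τ` back to `σ`, which uses symmetry.
    have h' := fun k => (h k).trans (eqVal_symm hM _ _)
    simp only [Formula.eval, le_himp_iff]
    refine (le_inf (inf_le_left.trans inf_le_left) ?_).trans (ihB h)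
    refine le_trans (le_inf (inf_le_left.trans inf_le_right) ?_)
      (himp_inf_le (a := A.eval M σ))
    exact (inf_le_inf_right _ inf_le_left).trans (ihA h')
  | all s A ih =>
    exact le_iInf fun d => (inf_le_inf_left c (iInf_le _ d)).trans (ih (lift d h))
  | ex s A ih =>
    simp only [Formula.eval, inf_iSup_eq]
    exact iSup_mono fun d => ih (lift d h)

end Models

end HAN

/-! ### Arithmetical propositions in models of `HA_Class` -/

namespace HAClass

variable {Ω : Type}

/-- The numbers of a model of `HA_Class`. -/
def reduct (M : FrameModel lang Ω) : FrameModel HAN.lang Ω where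
  Dom _ := M.Dom Srt.ι
  fn
    | .zero => fun ts => M.fn Fn.zero ts
    | .succ => fun ts => M.fn Fn.succ ts
    | .pred => fun ts => M.fn Fn.pred ts
    | .add => fun ts => M.fn Fn.add ts
    | .mul => fun ts => M.fn Fn.mul ts
  rel
    | .eq => fun ts => M.rel Rel.eq ts
    | .null => fun ts => M.rel Rel.null ts
    | .nat => fun ts => M.rel Rel.nat ts

section Values

variable (M : FrameModel lang Ω)

def memVal (a : M.Dom Srt.ι) (p : M.Dom Srt.κ) : Ω :=
  M.rel Rel.mem (fun i => match i with
    | 0 => a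
    | 1 => p)

variable (ρ : (s : Srt) → ℕ → M.Dom s)

@[simp] theorem eval_v (n : ℕ) : (v n).eval M ρ = ρ Srt.ι n := rfl

@[simp] theorem eval_c (n : ℕ) : (c n).eval M ρ = ρ Srt.κ n := rfl

@[simp] theorem eval_zero : zero.eval M ρ = HAN.zeroVal (reduct M) :=
  HAN.fn_zero (reduct M) _

@[simp] theorem eval_succ (t : Term lang Srt.ι) :
    (succ t).eval M ρ = HAN.succVal (reduct M) (t.eval M ρ) := HAN.fn_succ (reduct M) _

@[simp] theorem eval_pred (t : Term lang Srt.ι) :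
    (pred t).eval M ρ = HAN.predVal (reduct M) (t.eval M ρ) := HAN.fn_pred (reduct M) _

@[simp] theorem eval_add (t u : Term lang Srt.ι) :
    (add t u).eval M ρ = HAN.addVal (reduct M) (t.eval M ρ) (u.eval M ρ) :=
  HAN.fn_add (reduct M) _

@[simp] theorem eval_mul (t u : Term lang Srt.ι) :
    (mul t u).eval M ρ = HAN.mulVal (reduct M) (t.eval M ρ) (u.eval M ρ) :=
  HAN.fn_mul (reduct M) _

theorem eval_ofTerm {s : HAN.lang.Srt} (t : Term HAN.lang s) :
    (ofTerm t).eval M ρ = t.eval (reduct M) fun _ => ρ Srt.ι := by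
  induction t with
  | var s n => rfl
  | app f ts ih =>
    simp only [Term.eval]
    cases f with
    | zero => rw [HAN.fn_zero]; exact eval_zero M ρ
    | succ => rw [HAN.fn_succ, ← ih]; exact eval_succ M ρ _
    | pred => rw [HAN.fn_pred, ← ih]; exact eval_pred M ρ _
    | add => rw [HAN.fn_add, ← ih, ← ih]; exact eval_add M ρ _ _
    | mul => rw [HAN.fn_mul, ← ih, ← ih]; exact eval_mul M ρ _ _

variable [Order.Frame Ω]

@[simp] theorem eval_eq (t u : Term lang Srt.ι) :
    (eq t u).eval M ρ = HAN.eqVal (reduct M) (t.eval M ρ) (u.eval M ρ) :=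
  HAN.rel_eq (reduct M) _

@[simp] theorem eval_null (t : Term lang Srt.ι) :
    (null t).eval M ρ = HAN.nullVal (reduct M) (t.eval M ρ) := HAN.rel_null (reduct M) _

@[simp] theorem eval_nat (t : Term lang Srt.ι) :
    (nat t).eval M ρ = HAN.natVal (reduct M) (t.eval M ρ) := HAN.rel_nat (reduct M) _

@[simp] theorem eval_mem (t : Term lang Srt.ι) (p : Term lang Srt.κ) :
    (mem t p).eval M ρ = memVal M (t.eval M ρ) (p.eval M ρ) :=
  congrArg (M.rel Rel.mem) (funext fun i => by fin_cases i <;> rfl)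

theorem eval_all (A : Formula lang) :
    (all A).eval M ρ = ⨅ d, A.eval M (scons (S := lang.Srt) Srt.ι d ρ) := rfl

theorem eval_allC (A : Formula lang) :
    (allC A).eval M ρ = ⨅ p, A.eval M (scons (S := lang.Srt) Srt.κ p ρ) := rfl

theorem eval_ofFormula (A : Formula HAN.lang) :
    (ofFormula A).eval M ρ = A.eval (reduct M) fun _ => ρ Srt.ι := by
  have lift : ∀ (ρ : (s : lang.Srt) → ℕ → M.Dom s) (d : M.Dom Srt.ι),
      (fun _ => scons Srt.ι d ρ Srt.ι : (s : HAN.lang.Srt) → ℕ → (reduct M).Dom s) =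
        scons (S := HAN.lang.Srt) () d fun _ => ρ Srt.ι := by
    intro ρ d
    funext s n
    cases n <;> rfl
  induction A generalizing ρ with
  | rel R ts =>
    cases R with
    | eq =>
      refine (eval_eq M ρ (ofTerm (ts 0)) (ofTerm (ts 1))).trans ?_
      rw [eval_ofTerm, eval_ofTerm]
      exact (HAN.rel_eq (reduct M) fun i => (ts i).eval (reduct M) fun _ => ρ Srt.ι).symm
    | null =>
      refine (eval_null M ρ (ofTerm (ts 0))).trans ?_
      rw [eval_ofTerm]
      exact (HAN.rel_null (reduct M) fun i => (ts i).eval (reduct M) fun _ => ρ Srt.ι).symm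
    | nat =>
      refine (eval_nat M ρ (ofTerm (ts 0))).trans ?_
      rw [eval_ofTerm]
      exact (HAN.rel_nat (reduct M) fun i => (ts i).eval (reduct M) fun _ => ρ Srt.ι).symm
  | bot => rfl
  | top => rfl
  | and A B ihA ihB => simp only [ofFormula, Formula.eval, ihA, ihB]
  | or A B ihA ihB => simp only [ofFormula, Formula.eval, ihA, ihB]
  | imp A B ihA ihB => simp only [ofFormula, Formula.eval, ihA, ihB]
  | all s A ih =>
    refine iInf_congr fun d => (ih _).trans ?_
    exact congrArg (A.eval (reduct M)) (lift ρ d)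
  | ex s A ih =>
    refine iSup_congr fun d => (ih _).trans ?_
    exact congrArg (A.eval (reduct M)) (lift ρ d)

/-- The reduct satisfies the same arithmetical propositions. -/
theorem valid_ofFormula (A : Formula HAN.lang) :
    M.Valid (ofFormula A) ↔ (reduct M).Valid A := by
  constructor
  · intro h ρ
    -- Extending an assignment of numbers to both sorts requires some class; the parameter-free
    -- symbol for `⊤` shows that there is one.
    let p : M.Dom Srt.κ := M.fn (Fn.cls 0 .top fun _ h => h.elim) fun i => i.elim0
    let ρ' : (s : lang.Srt) → ℕ → M.Dom s := fun s => match s with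
      | .ι => ρ ()
      | .κ => fun _ => p
    exact (eval_ofFormula M ρ' A).symm.trans (h ρ')
  · exact fun h ρ => (eval_ofFormula M ρ A).trans (h _)

end Values

end HAClass

namespace HAClass

variable {Ω : Type} [Order.Frame Ω]

/-! ### From models of `HA_N` to models of `HA_Class` -/

section Expansion

/-- A model of `HA_N` with its definable classes: a class is a proposition together with the
values of its parameters. -/
def expand (M : FrameModel HAN.lang Ω) : FrameModel lang Ω where
  Dom
    | .ι => M.Dom ()
    | .κ => (ℕ → M.Dom ()) × Formula HAN.lang
  fn
    | .zero => fun ts => M.fn HAN.Fn.zero ts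
    | .succ => fun ts => M.fn HAN.Fn.succ ts
    | .pred => fun ts => M.fn HAN.Fn.pred ts
    | .add => fun ts => M.fn HAN.Fn.add ts
    | .mul => fun ts => M.fn HAN.Fn.mul ts
    -- Position `k` holds the value of index `k + 1` of `P`, index `0` being left for the element.
    -- The default zero is harmless, as `P` has no free index beyond `n`.
    | .cls n P _ => fun ts => (fun k => if h : k < n then ts ⟨k, h⟩ else HAN.zeroVal M, P)
  rel
    | .eq => fun ts => M.rel HAN.Rel.eq ts
    | .null => fun ts => M.rel HAN.Rel.null ts
    | .nat => fun ts => M.rel HAN.Rel.nat ts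
    | .mem => fun ts =>
      let p : (ℕ → M.Dom ()) × Formula HAN.lang := ts 1
      p.2.eval M (scons () (ts 0) fun _ => p.1)

theorem eval_reduct_expand (M : FrameModel HAN.lang Ω) (A : Formula HAN.lang)
    (ρ : (s : HAN.lang.Srt) → ℕ → M.Dom s) : A.eval (reduct (expand M)) ρ = A.eval M ρ := by
  have hf : (reduct (expand M)).fn = M.fn := by
    funext f
    cases f <;> rfl
  have hr : (reduct (expand M)).rel = M.rel := by
    funext R
    cases R <;> rfl
  -- The domains agree by definition, whereas the interpretations agree only after a case split on
  -- symbols; exposing the fields permits rewriting.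
  change A.eval ⟨M.Dom, (reduct (expand M)).fn, (reduct (expand M)).rel⟩ ρ = _
  rw [hf, hr]

theorem valid_ofFormula_expand (M : FrameModel HAN.lang Ω) (A : Formula HAN.lang) :
    (expand M).Valid (ofFormula A) ↔ M.Valid A :=
  (valid_ofFormula _ A).trans
    (forall_congr' fun ρ => by rw [← eval_reduct_expand M A ρ])

variable {M : FrameModel HAN.lang Ω} (hM : ∀ B ∈ HAN.Theory, M.Valid B)

include hM

/-- Equal elements satisfy the same propositions by congruence. For the converse, the class of all
`x` with `a = x` contains `a`, hence `b`. -/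
theorem eqVal_eq_iInf_formula (a b : M.Dom ()) :
    HAN.eqVal M a b = ⨅ p : (ℕ → M.Dom ()) × Formula HAN.lang,
      (p.2.eval M (scons () a fun _ => p.1) ⇨ p.2.eval M (scons () b fun _ => p.1)) := by
  apply le_antisymm
  · refine le_iInf fun p => le_himp_iff.2 (HAN.eval_of_eqVal hM _ fun k => ?_)
    cases k with
    | zero => exact le_rfl
    | succ k => exact le_top.trans (HAN.eqVal_refl hM _).ge
  · refine (iInf_le _ ((fun _ => a), HAN.eq (HAN.v 1) (HAN.v 0))).trans ?_
    simp [HAN.eqVal_refl hM]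

/-- One inequality is the induction schema. The other takes `N` as the class, for which both the
base case and the induction step have value `⊤`. -/
theorem natVal_eq_iInf_formula (a : M.Dom ()) :
    HAN.natVal M a = ⨅ p : (ℕ → M.Dom ()) × Formula HAN.lang,
      (p.2.eval M (scons () (HAN.zeroVal M) fun _ => p.1) ⇨
        (⨅ d, (HAN.natVal M d ⇨ p.2.eval M (scons () d fun _ => p.1) ⇨
          p.2.eval M (scons () (HAN.succVal M d) fun _ => p.1))) ⇨
        p.2.eval M (scons () a fun _ => p.1)) := by
  apply le_antisymm
  · refine le_iInf fun p => ?_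
    rw [himp_himp, le_himp_iff, inf_comm]
    exact HAN.eval_induction hM _ _ _
  · refine (iInf_le _ ((fun _ => a), HAN.nat (HAN.v 0))).trans ?_
    simp only [HAN.eval_nat, HAN.eval_v, scons_zero, HAN.natVal_zero hM, top_himp,
      fun d => himp_eq_top_iff.2 (HAN.natVal_succ hM d), himp_top, iInf_top, le_refl]

theorem valid_expand : ∀ B ∈ Theory, (expand M).Valid B := by
  have common : ∀ A ∈ HAN.Theory, (expand M).Valid (ofFormula A) := fun A hA =>
    (valid_ofFormula_expand M A).2 (hM A hA)
  intro B hB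
  cases hB with
  | eq_iff =>
    refine (FrameModel.valid_all _).2 ((FrameModel.valid_all _).2 fun ρ => ?_)
    rw [Formula.eval_iff_eq_top]
    simp only [eval_eq, eval_allC, Formula.eval, eval_mem, eval_v, eval_c]
    exact eqVal_eq_iInf_formula hM (ρ Srt.ι 1) (ρ Srt.ι 0)
  | nat_iff =>
    refine (FrameModel.valid_all _).2 fun ρ => ?_
    rw [Formula.eval_iff_eq_top]
    simp only [eval_nat, eval_allC, eval_all, Formula.eval, eval_mem, eval_v, eval_c, eval_zero,
      eval_succ]
    exact natVal_eq_iInf_formula hM (ρ Srt.ι 0)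
  | mem_cls n P hP =>
    refine (FrameModel.valid_alls _ _).2 fun ρ => ?_
    rw [Formula.eval_iff_eq_top, eval_mem, eval_ofFormula]
    refine Eq.trans ?_ (eval_reduct_expand M P _).symm
    refine Formula.eval_congr M P fun s k hk => ?_
    cases k with
    | zero => rfl
    | succ k =>
      have := hP _ hk
      exact dif_pos (show k < n by omega)
  | pred_zero => exact common _ .pred_zero
  | pred_succ => exact common _ .pred_succ
  | null_zero => exact common _ .null_zero
  | null_succ => exact common _ .null_succ
  | zero_add => exact common _ .zero_add
  | succ_add => exact common _ .succ_add
  | zero_mul => exact common _ .zero_mul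
  | succ_mul => exact common _ .succ_mul

end Expansion

/-! ### From models of `HA_Class` to models of `HA_N` -/

section Reduct

variable {M : FrameModel lang Ω} (hM : ∀ B ∈ Theory, M.Valid B)

include hM

theorem eqVal_eq_iInf_memVal (a b : (reduct M).Dom ()) :
    HAN.eqVal (reduct M) a b = ⨅ p, (memVal M a p ⇨ memVal M b p) := by
  have h := (FrameModel.valid_all _).1 ((FrameModel.valid_all _).1 (hM _ .eq_iff))
    fun s => match s with
      | .ι => fun k => if k = 0 then b else a
      | .κ => fun _ => M.fn (Fn.cls 0 .top fun _ h => h.elim) fun i => i.elim0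
  rw [Formula.eval_iff_eq_top] at h
  simp only [eval_eq, eval_allC, Formula.eval, eval_mem, eval_v, eval_c] at h
  exact h

theorem natVal_eq_iInf_memVal (a : (reduct M).Dom ()) :
    HAN.natVal (reduct M) a = ⨅ p, (memVal M (HAN.zeroVal (reduct M)) p ⇨
      (⨅ d, (HAN.natVal (reduct M) d ⇨ memVal M d p ⇨
        memVal M (HAN.succVal (reduct M) d) p)) ⇨ memVal M a p) := by
  have h := (FrameModel.valid_all _).1 (hM _ .nat_iff)
    fun s => match s with
      | .ι => fun _ => a
      | .κ => fun _ => M.fn (Fn.cls 0 .top fun _ h => h.elim) fun i => i.elim0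
  rw [Formula.eval_iff_eq_top] at h
  simp only [eval_nat, eval_allC, eval_all, Formula.eval, eval_mem, eval_v, eval_c, eval_zero,
    eval_succ] at h
  exact h

/-- Comprehension for arithmetical propositions with parameters. -/
theorem exists_memVal_eq (P : Formula HAN.lang)
    (ρ : (s : HAN.lang.Srt) → ℕ → (reduct M).Dom s) :
    ∃ p, ∀ a : (reduct M).Dom (), memVal M a p = P.eval (reduct M) (scons () a ρ) := by
  obtain ⟨n, hn⟩ := P.exists_hasFree_lt
  have hP : ∀ k, P.HasFree () k → k < n + 1 := fun k hk => (hn () k hk).trans n.lt_succ_self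
  let p : M.Dom Srt.κ := M.fn (Fn.cls n P hP) fun i => ρ () i
  refine ⟨p, fun a => ?_⟩
  have h := (FrameModel.valid_alls _ _).1 (hM _ (.mem_cls n P hP))
    fun s => match s with
      | .ι => fun k => scons (S := HAN.lang.Srt) () a ρ () k
      | .κ => fun _ => p
  rw [Formula.eval_iff_eq_top, eval_mem, eval_ofFormula] at h
  exact h

/-- By comprehension `P` with its parameters is a class, and equality is the meet over all classes.
-/
theorem leibniz (P : Formula HAN.lang) (ρ : (s : HAN.lang.Srt) → ℕ → (reduct M).Dom s)
    (a b : (reduct M).Dom ()) : HAN.eqVal (reduct M) a b ⊓ P.eval (reduct M) (scons () a ρ) ≤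
      P.eval (reduct M) (scons () b ρ) := by
  obtain ⟨p, hp⟩ := exists_memVal_eq hM P ρ
  rw [← le_himp_iff, ← hp, ← hp, eqVal_eq_iInf_memVal hM]
  exact iInf_le _ p

theorem eqVal_reduct_refl (a : (reduct M).Dom ()) : HAN.eqVal (reduct M) a a = ⊤ := by
  simp [eqVal_eq_iInf_memVal hM]

theorem eqVal_reduct_trans (a b d : (reduct M).Dom ()) :
    HAN.eqVal (reduct M) a b ⊓ HAN.eqVal (reduct M) b d ≤ HAN.eqVal (reduct M) a d := by
  rw [inf_comm]
  simpa using leibniz hM (HAN.eq (HAN.v 1) (HAN.v 0)) (fun _ _ => a) b d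

/-- Equality is compatible with every function defined by a term. -/
theorem eqVal_congr (t : Term HAN.lang ()) (ρ : (s : HAN.lang.Srt) → ℕ → (reduct M).Dom s)
    (a b : (reduct M).Dom ()) : HAN.eqVal (reduct M) a b ≤
      HAN.eqVal (reduct M) (t.eval (reduct M) (scons () a ρ))
        (t.eval (reduct M) (scons () b ρ)) := by
  -- The class used is that of all `x` with `t(a) = t(x)`. With `x` at index `0` and `a` at index
  -- `1`, the shifted copy of `t` reads `a`, while the lifted shift reads `x` and skips `a`.
  have h := leibniz hM (HAN.eq (t.subst (shiftSub (L := HAN.lang) ()))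
    (t.subst (liftSub (L := HAN.lang) () (shiftSub (L := HAN.lang) ())))) (scons () a ρ) a b
  have ht : ∀ d : (reduct M).Dom (),
      (t.subst (liftSub (L := HAN.lang) () (shiftSub (L := HAN.lang) ()))).eval (reduct M)
        (scons () d (scons () a ρ)) = t.eval (reduct M) (scons () d ρ) := by
    intro d
    rw [Term.eval_subst]
    congr 1
    funext s n
    cases n <;> rfl
  have hs : ∀ d : (reduct M).Dom (), (t.subst (shiftSub (L := HAN.lang) ())).eval (reduct M)
      (scons () d (scons () a ρ)) = t.eval (reduct M) (scons () a ρ) :=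
    fun d => Term.eval_shift (reduct M) () d (scons () a ρ) t
  simpa only [HAN.eval_eq, ht, hs, eqVal_reduct_refl hM, inf_top_eq] using h

/-- For a class `p` satisfying the base and step conditions, `N(a)` is used twice: to obtain `a ∈
p`, and to apply the step at `a`, which is relativized to `N`. -/
theorem natVal_reduct_succ (a : (reduct M).Dom ()) :
    HAN.natVal (reduct M) a ≤ HAN.natVal (reduct M) (HAN.succVal (reduct M) a) := by
  rw [natVal_eq_iInf_memVal hM (HAN.succVal (reduct M) a)]
  refine le_iInf fun p => ?_
  have h := (natVal_eq_iInf_memVal hM a).le.trans (iInf_le _ p)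
  rw [himp_himp, le_himp_iff] at h ⊢
  have hI := (inf_le_right (a := HAN.natVal (reduct M) a)).trans
    ((inf_le_right (a := memVal M (HAN.zeroVal (reduct M)) p)).trans
      (iInf_le (fun d => HAN.natVal (reduct M) d ⇨ memVal M d p ⇨
        memVal M (HAN.succVal (reduct M) d) p) a))
  rw [himp_himp, le_himp_iff] at hI
  exact (le_inf le_rfl (le_inf inf_le_left h)).trans hI

theorem valid_reduct : ∀ B ∈ HAN.Theory, (reduct M).Valid B := by
  have common : ∀ A, ofFormula A ∈ Theory → (reduct M).Valid A := fun A hA =>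
    (valid_ofFormula M A).1 (hM _ hA)
  intro B hB
  cases hB with
  | eq_refl =>
    refine (FrameModel.valid_all _).2 fun ρ => ?_
    simp [eqVal_reduct_refl hM]
  | eq_symm =>
    refine (FrameModel.valid_all _).2 ((FrameModel.valid_all _).2 fun ρ => ?_)
    -- Leibniz's principle for the class of all `x` with `x = a`, which contains `a` by reflexivity.
    simpa [Formula.eval, eqVal_reduct_refl hM] using
      leibniz hM (HAN.eq (HAN.v 0) (HAN.v 1)) (fun _ _ => ρ () 1) (ρ () 1) (ρ () 0)
  | eq_trans =>
    refine (FrameModel.valid_all _).2 ((FrameModel.valid_all _).2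
      ((FrameModel.valid_all _).2 fun ρ => ?_))
    simpa [Formula.eval] using eqVal_reduct_trans hM _ _ _
  | eq_succ =>
    refine (FrameModel.valid_all _).2 ((FrameModel.valid_all _).2 fun ρ => ?_)
    simpa [Formula.eval] using eqVal_congr hM (HAN.succ (HAN.v 0)) ρ (ρ () 1) (ρ () 0)
  | eq_pred =>
    refine (FrameModel.valid_all _).2 ((FrameModel.valid_all _).2 fun ρ => ?_)
    simpa [Formula.eval] using eqVal_congr hM (HAN.pred (HAN.v 0)) ρ (ρ () 1) (ρ () 0)
  | eq_add =>
    refine (FrameModel.valid_all _).2 ((FrameModel.valid_all _).2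
      ((FrameModel.valid_all _).2 ((FrameModel.valid_all _).2 fun ρ => ?_)))
    -- The arguments are replaced one at a time. Index `0` is the varying argument, so `HAN.v 2` and
    -- `HAN.v 3` denote `ρ () 1` and `ρ () 2`.
    have h₁ := eqVal_congr hM (HAN.add (HAN.v 0) (HAN.v 2)) ρ (ρ () 3) (ρ () 2)
    have h₂ := eqVal_congr hM (HAN.add (HAN.v 3) (HAN.v 0)) ρ (ρ () 1) (ρ () 0)
    simp only [HAN.eval_add, HAN.eval_v, scons_zero, scons_succ] at h₁ h₂
    simpa [Formula.eval] using (inf_le_inf h₁ h₂).trans (eqVal_reduct_trans hM _ _ _)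
  | eq_mul =>
    refine (FrameModel.valid_all _).2 ((FrameModel.valid_all _).2
      ((FrameModel.valid_all _).2 ((FrameModel.valid_all _).2 fun ρ => ?_)))
    have h₁ := eqVal_congr hM (HAN.mul (HAN.v 0) (HAN.v 2)) ρ (ρ () 3) (ρ () 2)
    have h₂ := eqVal_congr hM (HAN.mul (HAN.v 3) (HAN.v 0)) ρ (ρ () 1) (ρ () 0)
    simp only [HAN.eval_mul, HAN.eval_v, scons_zero, scons_succ] at h₁ h₂
    simpa [Formula.eval] using (inf_le_inf h₁ h₂).trans (eqVal_reduct_trans hM _ _ _)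
  | eq_null =>
    refine (FrameModel.valid_all _).2 ((FrameModel.valid_all _).2 fun ρ => ?_)
    simpa [Formula.eval] using leibniz hM (HAN.null (HAN.v 0)) ρ (ρ () 1) (ρ () 0)
  | eq_nat =>
    refine (FrameModel.valid_all _).2 ((FrameModel.valid_all _).2 fun ρ => ?_)
    simpa [Formula.eval] using leibniz hM (HAN.nat (HAN.v 0)) ρ (ρ () 1) (ρ () 0)
  | induction n P hP =>
    refine (FrameModel.valid_alls _ _).2 fun ρ => ?_
    obtain ⟨p, hp⟩ := exists_memVal_eq hM P ρ
    simp only [Formula.eval, HAN.eval_all, Formula.eval_inst, HAN.eval_zero, HAN.eval_nat,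
      HAN.eval_v, scons_zero, himp_eq_top_iff, le_himp_iff, le_iInf_iff]
    intro a
    -- With `N(a)` moved to the front, the axiom for `N`, taken at the class of `P`, is the required
    -- instance of induction.
    rw [inf_comm, ← le_himp_iff, ← himp_himp, natVal_eq_iInf_memVal hM]
    refine (iInf_le _ p).trans ?_
    simp only [hp]
    refine himp_le_himp_left (himp_le_himp_right (iInf_mono fun d => ?_))
    exact himp_le_himp_left (himp_le_himp_left (HAN.eval_succInst (reduct M) ρ P d).le)
  | nat_zero =>
    intro ρ
    simp only [HAN.eval_nat, HAN.eval_zero]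
    rw [natVal_eq_iInf_memVal hM]
    -- At zero the conclusion `0 ∈ p` is already the first hypothesis.
    exact iInf_eq_top.2 fun p => himp_eq_top_iff.2 le_himp
  | nat_succ =>
    refine (FrameModel.valid_all _).2 fun ρ => ?_
    simpa [Formula.eval] using natVal_reduct_succ hM _
  | pred_zero => exact common _ .pred_zero
  | pred_succ => exact common _ .pred_succ
  | null_zero => exact common _ .null_zero
  | null_succ => exact common _ .null_succ
  | zero_add => exact common _ .zero_add
  | succ_add => exact common _ .succ_add
  | zero_mul => exact common _ .zero_mul
  | succ_mul => exact common _ .succ_mul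

end Reduct

end HAClass

end ModArith

theorem mainTheorem6 (A : ModArith.Formula ModArith.HAN.lang) :
    ModArith.Provable ModArith.HAClass.Theory (ModArith.HAClass.ofFormula A) ↔
      ModArith.Provable ModArith.HAN.Theory A := by
  constructor
  · intro h
    refine ModArith.HAN.substClosed_theory.provable_of_forall_valid fun Ω _ M hM => ?_
    exact (ModArith.HAClass.valid_ofFormula_expand M A).1
      (h.valid _ (ModArith.HAClass.valid_expand hM))
  · intro h
    refine ModArith.HAClass.substClosed_theory.provable_of_forall_valid fun Ω _ M hM => ?_
    exact (ModArith.HAClass.valid_ofFormula M A).2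
      (h.valid _ (ModArith.HAClass.valid_reduct hM))
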